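/- Let $R$ be a ring and $X$ a metric space. For $n\ge 0$ let $C^n(X;R)$ be the $R$-module of all functions $\phi\colon X^{n+1}\to R$, with coboundary $(d\phi)(x_0,\dots,x_{n+1})=\sum_{i=0}^{n+1}(-1)^i\phi(x_0,\dots,\widehat{x_i},\dots,x_{n+1})$. Give $X^{n+1}$ the sup metric, let $\Delta\subset X^{n+1}$ be the diagonal, let $|\phi|=\{\sigma\in X^{n+1}:\phi(\sigma)\ne 0\}$, and let $\|\phi\|=\{x\in X:(x,\dots,x)\in\overline{|\phi|}\}$. Define the subcomplexes $$C_X^n(X;R)=\{\phi:\ |\phi|\cap N_r(\Delta)\text{ is bounded for every } r\},\qquad C_b^n(X;R)=\{\phi:\ \|\phi\|\text{ is bounded}\}$$ of $C^*(X;R)$; then $C_X^*(X;R)\subseteq C_b^*(X;R)$. Their cohomologies are the coarse cohomology $HX^*(X;R)$ and the boundedly supported cohomology $H_b^*(X;R)$. A space $Y$ is *locally acyclic* with coefficients in $R$ if for every $y\in Y$, every neighbourhood $U$ of $y$ and every degree $k\ge 0$ there is a neighbourhood $V\subseteq U$ of $y$ such that $V\hookrightarrow U$ induces the zero map on reduced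 singular homology $\widetilde H_k(\,\cdot\,;R)$. The space $X$ is *locally acyclic at infinity* with coefficients in $R$ if the complement of some bounded subset of $X$ is locally acyclic with coefficients in $R$. It is *uniformly acyclic at infinity* with coefficients in $R$ if there are non-decreasing functions $\mu,\rho\colon[0,\infty)\to[0,\infty)$ and a point $b\in X$ such that for every nonempty bounded $B\subseteq X$ of diameter $r$ with $d(b,B)\ge\mu(r)$, the inclusion of $B$ into its closed $\rho(r)$-neighbourhood $\{x\in X: d(x,B)\le\rho(r)\}$ induces the zero map on reduced singular homology $\widetilde H_k(\,\cdot\,;R)$ for all $k\ge 0$. **Theorem.** If $X$ is uniformly acyclic at infinity and locally acyclic at infinity with coefficients in $R$, then the inclusion $C_X^*(X;R)\hookrightarrow C_b^*(X;R)$ induces an isomorphism $HX^n(X;R)\to H_b^n(X;R)$ for every $n\ge 0$. -/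

import Mathlib

open CategoryTheory

universe u v

namespace CoarseCohomology

/-! ## Reduced singular homology and local and uniform acyclicity -/

/-- Singular homology `H_k(Y; R)`.  The coefficient module `R` is lifted to the universe of the
homology modules. -/
noncomputable abbrev singularHomology (R : Type v) [Ring R] (k : ℕ) (Y : TopCat.{u}) :
    ModuleCat.{max u v} R :=
  ((AlgebraicTopology.singularHomologyFunctor (ModuleCat.{max u v} R) k).obj
    (ModuleCat.of R (ULift.{u} R))).obj Y

/-- The map `H_k(Y; R) → H_k(Z; R)` induced by a continuous map. -/
noncomputable abbrev singularHomologyMap (R : Type v) [Ring R] (k : ℕ) {Y Z : TopCat.{u}}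
    (f : Y ⟶ Z) : singularHomology R k Y ⟶ singularHomology R k Z :=
  ((AlgebraicTopology.singularHomologyFunctor (ModuleCat.{max u v} R) k).obj
    (ModuleCat.of R (ULift.{u} R))).map f

/-- The reduced singular homology of a (nonempty) space `Y`: the kernel of
`H_k(Y; R) → H_k(pt; R)`. -/
noncomputable def reducedHomology (R : Type v) [Ring R] (k : ℕ) (Y : TopCat.{u}) :
    Submodule R (singularHomology R k Y) :=
  LinearMap.ker (singularHomologyMap R k
    (TopCat.ofHom (Y := PUnit.{u + 1}) ⟨fun _ : Y => PUnit.unit, continuous_const⟩)).hom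

/-- For subsets `A ⊆ B` of a space, the inclusion `A ↪ B` (both with the subspace topology)
induces the zero map on reduced singular homology in degree `k`. -/
def InclusionTrivial (R : Type v) [Ring R] (k : ℕ) {Y : Type u} [TopologicalSpace Y]
    {A B : Set Y} (h : A ⊆ B) : Prop :=
  ∀ z ∈ reducedHomology R k (TopCat.of A),
    (singularHomologyMap R k
      (TopCat.ofHom (Y := B) ⟨Set.inclusion h, continuous_inclusion h⟩)).hom z = 0

/-- `Y` is locally acyclic with coefficients in `R`: for every point `x`, every neighbourhood `U`
of `x` and every degree `k` there is a neighbourhood `V ⊆ U` of `x` such that `V ↪ U` is trivial on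
reduced singular homology in degree `k`. -/
def LocallyAcyclic (R : Type v) [Ring R] (Y : Type u) [TopologicalSpace Y] : Prop :=
  ∀ x : Y, ∀ U ∈ nhds x, ∀ k : ℕ, ∃ V ∈ nhds x, ∃ h : V ⊆ U, InclusionTrivial R k h

/-- The complement of some bounded subset of `X` (as a subspace) is locally acyclic. -/
def LocallyAcyclicAtInfinity (R : Type v) [Ring R] (X : Type u) [MetricSpace X] : Prop :=
  ∃ K : Set X, Bornology.IsBounded K ∧ LocallyAcyclic R (Kᶜ : Set X)

/-- There are non-decreasing control functions `μ, ρ : [0,∞) → [0,∞)` and a basepoint `b` such that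
for every (nonempty, bounded) set `B` of diameter `r` with `d(b,B) ≥ μ(r)`, the inclusion of `B` in
its `ρ(r)`-neighbourhood is trivial on reduced singular homology. -/
def UniformlyAcyclicAtInfinity (R : Type v) [Ring R] (X : Type u) [MetricSpace X] : Prop :=
  ∃ (μ ρ : NNReal → NNReal) (b : X), Monotone μ ∧ Monotone ρ ∧
    ∀ (r : NNReal) (B : Set X), B.Nonempty → Bornology.IsBounded B → Metric.diam B = r →
      (μ r : ℝ) ≤ Metric.infDist b B →
        ∀ k : ℕ, InclusionTrivial R k (Metric.self_subset_cthickening (δ := (ρ r : ℝ)) B)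

/-! ## Cochains -/

/-- All cochains of degree `n`: functions `X^{n+1} → R`. -/
abbrev Cochain (R : Type v) (X : Type u) (n : ℕ) : Type (max u v) := (Fin (n + 1) → X) → R

/-- The coboundary `(dφ)(x₀,…,x_{n+1}) = ∑ᵢ (-1)ⁱ φ(x₀,…,x̂ᵢ,…,x_{n+1})`. -/
def coboundary (R : Type v) [Ring R] (X : Type u) (n : ℕ) :
    Cochain R X n →ₗ[R] Cochain R X (n + 1) where
  toFun φ x := ∑ i : Fin (n + 2), (-1 : ℤ) ^ (i : ℕ) • φ (x ∘ i.succAbove)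
  map_add' φ ψ := by
    funext x
    simp [Finset.sum_add_distrib]
  map_smul' r φ := by
    funext x
    simp only [Pi.smul_apply, RingHom.id_apply, Finset.smul_sum]
    exact Finset.sum_congr rfl fun i _ => smul_comm _ _ _

theorem coboundary_coboundary (R : Type v) [Ring R] (X : Type u) (n : ℕ) (φ : Cochain R X n) :
    coboundary R X (n + 1) (coboundary R X n φ) = 0 := by
  funext x
  simp only [coboundary, LinearMap.coe_mk, AddHom.coe_mk, Finset.smul_sum, smul_smul,
    Pi.zero_apply, ← pow_add]
  rw [← Finset.sum_product']
  refine Finset.sum_involution (fun ij _ => (ij.1.succAbove ij.2, ij.2.predAbove ij.1)) ?_ ?_ ?_ ?_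
  · rintro ⟨i, j⟩ -
    have hx : (x ∘ (i.succAbove j).succAbove) ∘ (j.predAbove i).succAbove
        = (x ∘ i.succAbove) ∘ j.succAbove := by
      funext k
      simp only [Function.comp_apply]
      rw [Fin.succAbove_succAbove_succAbove_predAbove]
    dsimp only
    rw [hx, Fin.neg_one_pow_succAbove_add_predAbove]
    simp
  · rintro ⟨i, j⟩ - - h
    exact Fin.succAbove_ne i j (congrArg Prod.fst h)
  · rintro ⟨i, j⟩ -
    exact Finset.mem_univ _
  · rintro ⟨i, j⟩ -
    simp only [Prod.mk.injEq]
    exact ⟨Fin.succAbove_succAbove_predAbove i j, Fin.predAbove_predAbove_succAbove i j⟩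

/-- If `dφ` does not vanish at `x`, then `φ` does not vanish at some face of `x`. -/
theorem exists_face_mem_support {R : Type v} [Ring R] {X : Type u} {n : ℕ} {φ : Cochain R X n}
    {x : Fin (n + 2) → X} (hx : x ∈ Function.support (coboundary R X n φ)) :
    ∃ i : Fin (n + 2), x ∘ i.succAbove ∈ Function.support φ := by
  by_contra! h
  apply hx
  simp only [Function.mem_support, not_not] at h
  simp [coboundary, h]

section Metric

variable (R : Type v) [Ring R] (X : Type u) [MetricSpace X]

/-- The diagonal point `(x,…,x)` of `X^{n+1}`. -/
abbrev diag {X : Type u} (n : ℕ) (x : X) : Fin (n + 1) → X := fun _ => x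

variable {R X} in
/-- `‖φ‖`: the set of points `x` of `X` such that `(x,…,x)` lies in the closure of the support
of `φ` in `X^{n+1}`. -/
def diagSupport {n : ℕ} (φ : Cochain R X n) : Set X :=
  {x | diag n x ∈ closure (Function.support φ)}

/-- `C_b^n(X; R)`: the cochains `φ` for which `‖φ‖` is bounded. -/
def boundedCochains (n : ℕ) : Submodule R (Cochain R X n) where
  carrier := {φ | Bornology.IsBounded (diagSupport φ)}
  zero_mem' := by
    have : diagSupport (0 : Cochain R X n) = ∅ := by
      ext x
      simp [diagSupport, Function.support_zero]
    simp [this]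
  add_mem' {φ ψ} hφ hψ := by
    refine (Bornology.IsBounded.union hφ hψ).subset fun x hx => ?_
    have := closure_mono (Function.support_add φ ψ) hx
    rwa [closure_union] at this
  smul_mem' r φ hφ := by
    refine Bornology.IsBounded.subset hφ fun x hx => ?_
    exact closure_mono (Function.support_const_smul_subset r φ) hx

/-- `C_X^n(X; R)`, the coarse cochains: those `φ` for which the intersection of the support of `φ`
with the `r`-neighbourhood of the diagonal of `X^{n+1}` (with the sup metric) is bounded,
for every `r`. -/
def coarseCochains (n : ℕ) : Submodule R (Cochain R X n) where
  carrier := {φ | ∀ r : ℝ, Bornology.IsBounded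
    (Function.support φ ∩ Metric.thickening r (Set.range (diag (X := X) n)))}
  zero_mem' r := by simp [Function.support_zero]
  add_mem' {φ ψ} hφ hψ r := by
    refine (Bornology.IsBounded.union (hφ r) (hψ r)).subset fun σ hσ => ?_
    rcases Function.support_add φ ψ hσ.1 with h | h
    · exact Or.inl ⟨h, hσ.2⟩
    · exact Or.inr ⟨h, hσ.2⟩
  smul_mem' s φ hφ r := by
    refine (hφ r).subset fun σ hσ => ⟨fun h => hσ.1 (by simp [h]), hσ.2⟩

theorem coboundary_mem_boundedCochains (n : ℕ) :
    ∀ φ ∈ boundedCochains R X n, coboundary R X n φ ∈ boundedCochains R X (n + 1) := by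
  intro φ hφ
  refine Bornology.IsBounded.subset hφ fun x hx => ?_
  have h1 : Function.support (coboundary R X n φ) ⊆
      ⋃ i : Fin (n + 2), (fun y : Fin (n + 2) → X => y ∘ i.succAbove) ⁻¹' Function.support φ := by
    intro y hy
    obtain ⟨i, hi⟩ := exists_face_mem_support hy
    exact Set.mem_iUnion.2 ⟨i, hi⟩
  have h2 := closure_mono h1 hx
  rw [closure_iUnion_of_finite] at h2
  obtain ⟨i, hi⟩ := Set.mem_iUnion.1 h2
  have hc : Continuous (fun y : Fin (n + 2) → X => y ∘ i.succAbove) :=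
    continuous_pi fun k => continuous_apply _
  exact hc.closure_preimage_subset _ hi

theorem coboundary_mem_coarseCochains (n : ℕ) :
    ∀ φ ∈ coarseCochains R X n, coboundary R X n φ ∈ coarseCochains R X (n + 1) := by
  intro φ hφ r
  rcases isEmpty_or_nonempty X with hX | ⟨⟨c⟩⟩
  · exact (Set.toFinite _).isBounded
  obtain ⟨M, hM⟩ := (hφ r).subset_closedBall (diag n c)
  refine (Metric.isBounded_closedBall (x := diag (n + 1) c) (r := r + (r + M))).subset ?_
  rintro σ ⟨hσ, hr⟩
  obtain ⟨i, hi⟩ := exists_face_mem_support hσ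
  obtain ⟨_, ⟨x, rfl⟩, hx⟩ := Metric.mem_thickening_iff.1 hr
  have hr0 : 0 < r := lt_of_le_of_lt dist_nonneg hx
  have hf : dist (σ ∘ i.succAbove) (diag n x) < r :=
    (dist_pi_lt_iff hr0).2 fun k => (dist_pi_lt_iff hr0).1 hx (i.succAbove k)
  have hb := hM ⟨hi, Metric.mem_thickening_iff.2 ⟨_, ⟨x, rfl⟩, hf⟩⟩
  have h0 : dist x c ≤ r + M :=
    calc dist x c ≤ dist x ((σ ∘ i.succAbove) 0) + dist ((σ ∘ i.succAbove) 0) c :=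
          dist_triangle _ _ _
      _ ≤ r + M := by
          refine add_le_add ?_ ?_
          · rw [dist_comm]
            exact ((dist_pi_lt_iff hr0).1 hf 0).le
          · exact (dist_le_pi_dist (σ ∘ i.succAbove) (diag n c) 0).trans hb
  rw [Metric.mem_closedBall]
  refine (dist_triangle _ (diag (n + 1) x) _).trans (add_le_add hx.le ?_)
  rw [show dist (diag (n + 1) x) (diag (n + 1) c) = dist x c from dist_pi_const x c]
  exact h0

theorem coarseCochains_le_boundedCochains (n : ℕ) :
    coarseCochains R X n ≤ boundedCochains R X n := by
  intro φ hφ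
  have hb := (hφ 1).closure
  have himg := (LipschitzWith.eval (α := fun _ : Fin (n + 1) => X) 0).isBounded_image hb
  refine himg.subset fun x hx => ⟨diag n x, ?_, rfl⟩
  have hmem : diag n x ∈ Metric.thickening 1 (Set.range (diag (X := X) n)) :=
    Metric.self_subset_thickening one_pos _ ⟨x, rfl⟩
  rw [Set.inter_comm]
  exact Metric.isOpen_thickening.inter_closure ⟨hmem, hx⟩

/-- The cochain complex `C_b^*(X; R)`; its cohomology is the boundedly supported cohomology. -/
noncomputable def boundedComplex : CochainComplex (ModuleCat.{max u v} R) ℕ :=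
  CochainComplex.of (fun n => ModuleCat.of R (boundedCochains R X n))
    (fun n => ModuleCat.ofHom
      ((coboundary R X n).restrict (coboundary_mem_boundedCochains R X n)))
    (fun n => by
      apply ModuleCat.hom_ext
      apply LinearMap.ext
      intro φ
      exact Subtype.ext (coboundary_coboundary R X n φ.1))

/-- The cochain complex `C_X^*(X; R)`; its cohomology is the coarse cohomology. -/
noncomputable def coarseComplex : CochainComplex (ModuleCat.{max u v} R) ℕ :=
  CochainComplex.of (fun n => ModuleCat.of R (coarseCochains R X n))
    (fun n => ModuleCat.ofHom
      ((coboundary R X n).restrict (coboundary_mem_coarseCochains R X n)))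
    (fun n => by
      apply ModuleCat.hom_ext
      apply LinearMap.ext
      intro φ
      exact Subtype.ext (coboundary_coboundary R X n φ.1))

/-- The inclusion of cochain complexes `C_X^*(X; R) ↪ C_b^*(X; R)`. -/
noncomputable def coarseInclusion : coarseComplex R X ⟶ boundedComplex R X :=
  CochainComplex.ofHom
    (fun n => ModuleCat.ofHom (Submodule.inclusion (coarseCochains_le_boundedCochains R X n)))
    (fun n => by
      dsimp only [coarseComplex, boundedComplex]
      rw [CochainComplex.of_d, CochainComplex.of_d]
      rfl)

/-- Coarse cohomology `HX^n(X; R)`. -/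
noncomputable abbrev coarseCohomology (n : ℕ) : ModuleCat.{max u v} R :=
  (coarseComplex R X).homology n

/-- Boundedly supported cohomology `H_b^n(X; R)`. -/
noncomputable abbrev boundedCohomology (n : ℕ) : ModuleCat.{max u v} R :=
  (boundedComplex R X).homology n

/-- The map `HX^n(X; R) → H_b^n(X; R)` induced by the inclusion of cochain complexes. -/
noncomputable abbrev coarseToBounded (n : ℕ) :
    coarseCohomology R X n ⟶ boundedCohomology R X n :=
  HomologicalComplex.homologyMap (coarseInclusion R X) n

end Metric

end CoarseCohomology

/-! Everything reduces to one claim, `exists_sub_coboundary_mem_coarseCochains`: a boundedly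
supported cochain `ψ` of positive degree whose coboundary is coarse becomes coarse after subtracting
`dθ` for some boundedly supported `θ`. For a boundedly supported cocycle this gives surjectivity;
for a boundedly supported primitive of a coarse cocycle it gives injectivity. In degree zero the two
kinds of cochains coincide.

Far out, `ψ` is only known to vanish on very small tuples, whereas coarseness asks for vanishing on
tuples of any bounded size. So a tuple `σ` is replaced by a chain `F σ` of tuples so small that `ψ`
vanishes on them. To build `F`, the tuple is filled by a singular chain, one degree at a time.
Uniform acyclicity keeps the filling of a far tuple within a distance that depends only on the size
of the tuple; local acyclicity keeps the filling of a tuple near a point close to that point. A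
single system of fillings has to work for all scales and all points at once, and this is achieved by
taking each filling of almost minimal size, with a slack no larger than the tuple itself
(`exists_filling_system`, `isFilled_of_far`, `isFilled_of_near`). Barycentric subdivision, iterated
a number of times that depends on the singular simplex, then yields a chain map from singular chains
to tuples subordinate to any given open cover (`exists_smallTuples`).

Coning from the first vertex gives `H` with `∂H + H∂ = id - F` on the tuples all of whose iterated
faces are filled. With `θ = ψ ∘ H` one gets `ψ - dθ = ψ ∘ F + dψ ∘ H`. On far tuples of bounded size
the first term vanishes because `F` is subordinate to a cover adapted to `ψ`, and the second because
`dψ` is coarse and `H` moves a controlled distance. The local control of `H` makes `θ` boundedly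
supported. -/

namespace CoarseCohomology

/-! ## Free modules on simplices -/

section FaceBoundary

variable (R : Type v) [Ring R] {K L M K' L' : Type*}

/-- The alternating sum of the maps of free modules induced by a family of face maps. -/
noncomputable def faceBoundary {n : ℕ} (face : Fin (n + 2) → K → L) :
    (K →₀ R) →ₗ[R] (L →₀ R) :=
  ∑ i : Fin (n + 2), (-1 : ℤ) ^ (i : ℕ) • Finsupp.lmapDomain R R (face i)

variable {R}

theorem faceBoundary_apply {n : ℕ} (face : Fin (n + 2) → K → L) (c : K →₀ R) :
    faceBoundary R face c =
      ∑ i : Fin (n + 2), (-1 : ℤ) ^ (i : ℕ) • Finsupp.mapDomain (face i) c := by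
  simp [faceBoundary, LinearMap.sum_apply]

theorem faceBoundary_single {n : ℕ} (face : Fin (n + 2) → K → L) (x : K) (r : R) :
    faceBoundary R face (Finsupp.single x r) =
      ∑ i : Fin (n + 2), (-1 : ℤ) ^ (i : ℕ) • Finsupp.single (face i x) r := by
  simp [faceBoundary_apply, Finsupp.mapDomain_single]

/-- The terms cancel in pairs: the simplicial identity `h` matches the pair of indices `(i, j)` with
`(i.succAbove j, j.predAbove i)`, which occurs with the opposite sign. -/
theorem faceBoundary_faceBoundary {n : ℕ} (face₁ : Fin (n + 3) → K → L)
    (face₂ : Fin (n + 2) → L → M)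
    (h : ∀ i j x, face₂ (j.predAbove i) (face₁ (i.succAbove j) x) = face₂ j (face₁ i x))
    (c : K →₀ R) : faceBoundary R face₂ (faceBoundary R face₁ c) = 0 := by
  simp only [faceBoundary_apply, Finsupp.mapDomain_finsetSum, Finsupp.mapDomain_smul,
    Finset.smul_sum, smul_smul, ← pow_add, ← Finsupp.mapDomain_comp]
  rw [Finset.sum_comm, ← Finset.sum_product']
  refine Finset.sum_involution (fun ij _ => (ij.1.succAbove ij.2, ij.2.predAbove ij.1)) ?_ ?_ ?_ ?_
  · rintro ⟨i, j⟩ -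
    have hx : face₂ (j.predAbove i) ∘ face₁ (i.succAbove j) = face₂ j ∘ face₁ i :=
      funext fun x => h i j x
    dsimp only
    rw [hx, add_comm ((j : Fin _) : ℕ), add_comm ((j.predAbove i : Fin _) : ℕ),
      Fin.neg_one_pow_succAbove_add_predAbove]
    simp
  · rintro ⟨i, j⟩ - - h
    exact Fin.succAbove_ne i j (congrArg Prod.fst h)
  · rintro ⟨i, j⟩ -
    exact Finset.mem_univ _
  · rintro ⟨i, j⟩ -
    simp only [Prod.mk.injEq]
    exact ⟨Fin.succAbove_succAbove_predAbove i j, Fin.predAbove_predAbove_succAbove i j⟩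

theorem faceBoundary_mapDomain {n : ℕ} (face : Fin (n + 2) → K → L) (face' : Fin (n + 2) → K' → L')
    (f : K → K') (g : L → L') (h : ∀ i x, face' i (f x) = g (face i x)) (c : K →₀ R) :
    faceBoundary R face' (Finsupp.mapDomain f c) =
      Finsupp.mapDomain g (faceBoundary R face c) := by
  simp only [faceBoundary_apply, Finsupp.mapDomain_finsetSum, Finsupp.mapDomain_smul,
    ← Finsupp.mapDomain_comp]
  refine Finset.sum_congr rfl fun i _ => ?_
  rw [show face' i ∘ f = g ∘ face i from funext fun x => h i x]

theorem faceBoundary_mem_supported {n : ℕ} (face : Fin (n + 2) → K → L) {s : Set K} {t : Set L}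
    (h : ∀ i, ∀ x ∈ s, face i x ∈ t) {c : K →₀ R} (hc : c ∈ Finsupp.supported R R s) :
    faceBoundary R face c ∈ Finsupp.supported R R t := by
  classical
  rw [faceBoundary_apply]
  refine Submodule.sum_mem _ fun i _ => zsmul_mem ?_ _
  intro y hy
  obtain ⟨x, hx, rfl⟩ := Finset.mem_image.1 (Finsupp.mapDomain_support hy)
  exact h i x (hc hx)

/-- Chains with support in `s` are spanned by the generators in `s`. This reduces support estimates
to a single simplex. -/
theorem map_mem_of_mem_supported {N : Type*} [AddCommGroup N] [Module R N] (f : (K →₀ R) →ₗ[R] N)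
    (P : Submodule R N) {s : Set K} (h : ∀ x ∈ s, f (Finsupp.single x 1) ∈ P) {c : K →₀ R}
    (hc : c ∈ Finsupp.supported R R s) : f c ∈ P := by
  rw [Finsupp.supported_eq_span_single] at hc
  have : Submodule.span R ((fun i => Finsupp.single i (1 : R)) '' s) ≤ P.comap f := by
    rw [Submodule.span_le]
    rintro _ ⟨x, hx, rfl⟩
    exact h x hx
  exact this hc

theorem single_one_mem_supported {s : Set K} {x : K} (h : x ∈ s) :
    Finsupp.single x (1 : R) ∈ Finsupp.supported R R s :=
  Finsupp.single_mem_supported R 1 h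

theorem mapDomain_mem_supported {s : Set K} {t : Set L} (f : K → L) (h : ∀ x ∈ s, f x ∈ t)
    {c : K →₀ R} (hc : c ∈ Finsupp.supported R R s) :
    Finsupp.mapDomain f c ∈ Finsupp.supported R R t :=
  map_mem_of_mem_supported (Finsupp.lmapDomain R R f) _
    (fun x hx => by
      rw [Finsupp.lmapDomain_apply, Finsupp.mapDomain_single]
      exact single_one_mem_supported (h x hx)) hc

theorem eqOn_supported {N : Type*} [AddCommGroup N] [Module R N] {f g : (K →₀ R) →ₗ[R] N}
    {s : Set K} (h : ∀ x ∈ s, f (Finsupp.single x 1) = g (Finsupp.single x 1)) {c : K →₀ R}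
    (hc : c ∈ Finsupp.supported R R s) : f c = g c :=
  sub_eq_zero.1 (by
    simpa using map_mem_of_mem_supported (f - g) ⊥ (fun x hx => by simp [h x hx]) hc)

/-- The sum of the coefficients of a chain. -/
noncomputable def augmentation (R : Type v) [Ring R] (K : Type*) : (K →₀ R) →ₗ[R] R :=
  Finsupp.linearCombination R fun _ => 1

@[simp]
theorem augmentation_single (x : K) (r : R) :
    augmentation R K (Finsupp.single x r) = r := by
  simp [augmentation]

theorem augmentation_mapDomain (f : K → L) (c : K →₀ R) :
    augmentation R L (Finsupp.mapDomain f c) = augmentation R K c := by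
  simp [augmentation, Finsupp.linearCombination_mapDomain, Function.comp_def]

theorem augmentation_faceBoundary (face : Fin 2 → K → L) (c : K →₀ R) :
    augmentation R L (faceBoundary (n := 0) R face c) = 0 := by
  simp [faceBoundary_apply, Fin.sum_univ_two, augmentation_mapDomain]

end FaceBoundary

/-! ## Chains on tuples of points -/

section TupleChains

variable (R : Type v) [Ring R] {X Y : Type*}

/-- Finite `R`-linear combinations of `(n+1)`-tuples of points of `X`. -/
abbrev TupleChain (X : Type*) (n : ℕ) : Type _ := (Fin (n + 1) → X) →₀ R

/-- The boundary of chains on tuples. -/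
noncomputable def tupleBoundary (X : Type*) (n : ℕ) :
    TupleChain R X (n + 1) →ₗ[R] TupleChain R X n :=
  faceBoundary (n := n) R fun (i : Fin (n + 2)) (x : Fin (n + 2) → X) => x ∘ i.succAbove

variable {R}

theorem tupleBoundary_single {n : ℕ} (τ : Fin (n + 2) → X) (r : R) :
    tupleBoundary R X n (Finsupp.single τ r) =
      ∑ i : Fin (n + 2), (-1 : ℤ) ^ (i : ℕ) • Finsupp.single (τ ∘ i.succAbove) r :=
  faceBoundary_single _ _ _

theorem augmentation_tupleBoundary (c : TupleChain R X 1) :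
    augmentation R _ (tupleBoundary R X 0 c) = 0 :=
  augmentation_faceBoundary _ c

theorem comp_succAbove_comp_succAbove {n : ℕ} (x : Fin (n + 3) → X) (i : Fin (n + 3))
    (j : Fin (n + 2)) :
    (x ∘ (i.succAbove j).succAbove) ∘ (j.predAbove i).succAbove
      = (x ∘ i.succAbove) ∘ j.succAbove := by
  funext k
  simp only [Function.comp_apply]
  rw [Fin.succAbove_succAbove_succAbove_predAbove]

theorem tupleBoundary_tupleBoundary {n : ℕ} (c : TupleChain R X (n + 2)) :
    tupleBoundary R X n (tupleBoundary R X (n + 1) c) = 0 :=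
  faceBoundary_faceBoundary _ _ (fun i j x => comp_succAbove_comp_succAbove x i j) c

/-- The chains on tuples of points of `Y ⊆ X`. -/
abbrev tupleChainsIn (R : Type v) [Ring R] (Y : Set X) (n : ℕ) :
    Submodule R (TupleChain R X n) :=
  Finsupp.supported R R {τ | Set.range τ ⊆ Y}

theorem tupleBoundary_mem_tupleChainsIn {A : Set X} {n : ℕ} {c : TupleChain R X (n + 1)}
    (hc : c ∈ tupleChainsIn R A (n + 1)) : tupleBoundary R X n c ∈ tupleChainsIn R A n := by
  refine faceBoundary_mem_supported (n := n)
    (fun (i : Fin (n + 2)) (x : Fin (n + 2) → X) => x ∘ i.succAbove)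
    (s := {τ | Set.range τ ⊆ A}) (t := {τ | Set.range τ ⊆ A}) (fun i x hx => ?_) hc
  exact (Set.range_comp_subset_range _ _).trans hx

/-- The cone on a chain of tuples with apex `x`. -/
noncomputable def cone (R : Type v) [Ring R] (n : ℕ) (x : X) :
    TupleChain R X n →ₗ[R] TupleChain R X (n + 1) :=
  Finsupp.lmapDomain R R (Fin.cons (α := fun _ => X) x)

theorem cone_single {n : ℕ} (x : X) (τ : Fin (n + 1) → X) (r : R) :
    cone R n x (Finsupp.single τ r) = Finsupp.single (Fin.cons (α := fun _ => X) x τ) r := by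
  simp [cone, Finsupp.mapDomain_single]

theorem cons_comp_zero_succAbove {n : ℕ} (x : X) (τ : Fin (n + 1) → X) :
    (Fin.cons (α := fun _ => X) x τ : Fin (n + 2) → X) ∘ (0 : Fin (n + 2)).succAbove = τ := by
  funext k
  simp

theorem cons_comp_succ_succAbove {n : ℕ} (x : X) (τ : Fin (n + 2) → X) (i : Fin (n + 2)) :
    (Fin.cons (α := fun _ => X) x τ : Fin (n + 3) → X) ∘ i.succ.succAbove
      = Fin.cons (α := fun _ => X) x (τ ∘ i.succAbove) := by
  funext k
  refine Fin.cases ?_ (fun k => ?_) k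
  · simp
  · simp

/-- Deleting the apex returns the base, and every other face is the cone on a face of the base with
its sign shifted by one. -/
theorem tupleBoundary_cone {n : ℕ} (x : X) (c : TupleChain R X (n + 1)) :
    tupleBoundary R X (n + 1) (cone R (n + 1) x c) = c - cone R n x (tupleBoundary R X n c) := by
  suffices h : tupleBoundary R X (n + 1) ∘ₗ cone R (n + 1) x =
      LinearMap.id - cone R n x ∘ₗ tupleBoundary R X n from LinearMap.congr_fun h c
  refine Finsupp.lhom_ext fun τ r => ?_
  simp only [LinearMap.comp_apply, LinearMap.sub_apply, LinearMap.id_apply, cone_single,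
    tupleBoundary_single, map_sum, map_zsmul]
  rw [Fin.sum_univ_succ, cons_comp_zero_succAbove]
  simp only [cons_comp_succ_succAbove, Fin.val_succ, pow_succ, Fin.val_zero, pow_zero, one_smul,
    mul_neg, mul_one, neg_smul, Finset.sum_neg_distrib, sub_eq_add_neg]

theorem tupleBoundary_cone_zero (x : X) (c : TupleChain R X 0) :
    tupleBoundary R X 0 (cone R 0 x c) =
      c - augmentation R _ c • Finsupp.single (fun _ => x) 1 := by
  suffices h : tupleBoundary R X 0 ∘ₗ cone R 0 x =
      LinearMap.id - (augmentation R _).smulRight (Finsupp.single (fun _ => x) 1) from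
    LinearMap.congr_fun h c
  refine Finsupp.lhom_ext fun τ r => ?_
  simp only [LinearMap.comp_apply, LinearMap.sub_apply, LinearMap.id_apply, cone_single,
    tupleBoundary_single, LinearMap.smulRight_apply, augmentation_single]
  have h : (Fin.cons (α := fun _ => X) x τ : Fin 2 → X) ∘ (1 : Fin 2).succAbove = fun _ => x := by
    funext k
    obtain rfl := Subsingleton.elim k 0
    simp
  rw [Fin.sum_univ_two, cons_comp_zero_succAbove, h]
  simp [sub_eq_add_neg, Finsupp.smul_single]

theorem cone_mem_tupleChainsIn {A : Set X} {n : ℕ} {x : X} (hx : x ∈ A) {c : TupleChain R X n}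
    (hc : c ∈ tupleChainsIn R A n) : cone R n x c ∈ tupleChainsIn R A (n + 1) := by
  refine mapDomain_mem_supported _ (fun τ hτ => ?_) hc
  rintro _ ⟨i, rfl⟩
  refine Fin.cases ?_ (fun i => ?_) i
  · simpa using hx
  · simpa using hτ ⟨i, rfl⟩

/-- The map of tuple chains induced by a map of sets. -/
noncomputable def mapTuples (R : Type v) [Ring R] (f : X → Y) (n : ℕ) :
    TupleChain R X n →ₗ[R] TupleChain R Y n :=
  Finsupp.lmapDomain R R (f ∘ ·)

theorem mapTuples_single {n : ℕ} (f : X → Y) (τ : Fin (n + 1) → X) (r : R) :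
    mapTuples R f n (Finsupp.single τ r) = Finsupp.single (f ∘ τ) r := by
  simp [mapTuples, Finsupp.mapDomain_single]

theorem tupleBoundary_mapTuples {n : ℕ} (f : X → Y) (c : TupleChain R X (n + 1)) :
    tupleBoundary R Y n (mapTuples R f (n + 1) c) = mapTuples R f n (tupleBoundary R X n c) :=
  faceBoundary_mapDomain (n := n) _ _ (f ∘ ·) (f ∘ ·) (fun _ _ => rfl) c

theorem cone_mapTuples {n : ℕ} (f : X → Y) (x : X) (c : TupleChain R X n) :
    cone R n (f x) (mapTuples R f n c) = mapTuples R f (n + 1) (cone R n x c) := by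
  simp only [cone, mapTuples, Finsupp.lmapDomain_apply, ← Finsupp.mapDomain_comp]
  congr 1
  funext τ
  exact (Fin.comp_cons f x τ).symm

/-- Evaluation of a cochain on chains. -/
noncomputable def evalCochain {X : Type u} {n : ℕ} (φ : Cochain R X n) :
    TupleChain R X n →ₗ[R] R :=
  Finsupp.linearCombination R φ

@[simp]
theorem evalCochain_single {X : Type u} {n : ℕ} (φ : Cochain R X n) (τ : Fin (n + 1) → X) (r : R) :
    evalCochain φ (Finsupp.single τ r) = r * φ τ := by
  simp [evalCochain]

theorem evalCochain_coboundary {X : Type u} {n : ℕ} (φ : Cochain R X n)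
    (c : TupleChain R X (n + 1)) :
    evalCochain (coboundary R X n φ) c = evalCochain φ (tupleBoundary R X n c) := by
  suffices h : evalCochain (coboundary R X n φ) = evalCochain φ ∘ₗ tupleBoundary R X n from
    LinearMap.congr_fun h c
  refine Finsupp.lhom_ext fun τ r => ?_
  simp only [LinearMap.comp_apply, tupleBoundary_single, map_sum, map_zsmul, evalCochain_single,
    coboundary, LinearMap.coe_mk, AddHom.coe_mk, Finset.mul_sum, mul_smul_comm]

theorem evalCochain_eq_zero {X : Type u} {n : ℕ} {φ : Cochain R X n} {s : Set (Fin (n + 1) → X)}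
    (h : ∀ τ ∈ s, φ τ = 0) {c : TupleChain R X n} (hc : c ∈ Finsupp.supported R R s) :
    evalCochain φ c = 0 := by
  simpa using map_mem_of_mem_supported (evalCochain φ) ⊥ (fun τ hτ => by simp [h τ hτ]) hc

end TupleChains

/-! ## Iterated barycentric subdivision of chains on tuples -/

theorem linearMap_ext_single {R : Type*} [Ring R] {K N : Type*} [AddCommGroup N] [Module R N]
    {f g : (K →₀ R) →ₗ[R] N} (h : ∀ x, f (Finsupp.single x 1) = g (Finsupp.single x 1)) : f = g :=
  LinearMap.ext fun c => eqOn_supported (s := Set.univ) (fun x _ => h x) (by simp)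

section Subdivision

variable (R : Type v) [Ring R] {Q Q' : Type*} (b : ∀ n, (Fin (n + 1) → Q) → Q)
  (b' : ∀ n, (Fin (n + 1) → Q') → Q')

/-- Barycentric subdivision of tuple chains, with respect to a choice of barycentres `b`. -/
noncomputable def subdivision : ∀ n, TupleChain R Q n →ₗ[R] TupleChain R Q n
  | 0 => LinearMap.id
  | n + 1 => Finsupp.linearCombination R fun σ =>
      cone R n (b (n + 1) σ) (subdivision n (tupleBoundary R Q n (Finsupp.single σ 1)))

/-- The chain homotopy from the identity to barycentric subdivision. -/
noncomputable def subdivisionHomotopy : ∀ n, TupleChain R Q n →ₗ[R] TupleChain R Q (n + 1)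
  | 0 => 0
  | n + 1 => Finsupp.linearCombination R fun σ =>
      cone R (n + 1) (b (n + 1) σ) (Finsupp.single σ 1 -
        subdivisionHomotopy n (tupleBoundary R Q n (Finsupp.single σ 1)))

/-- The chain homotopy from the identity to the `m`-fold barycentric subdivision. -/
noncomputable def subdivisionHomotopyIter (n m : ℕ) :
    TupleChain R Q n →ₗ[R] TupleChain R Q (n + 1) :=
  ∑ i ∈ Finset.range m, subdivisionHomotopy R b n ∘ₗ (subdivision R b n) ^ i

variable {R b b'}

theorem subdivision_succ_single {n : ℕ} (σ : Fin (n + 2) → Q) :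
    subdivision R b (n + 1) (Finsupp.single σ 1) =
      cone R n (b (n + 1) σ) (subdivision R b n (tupleBoundary R Q n (Finsupp.single σ 1))) := by
  rw [subdivision, Finsupp.linearCombination_single, one_smul]

theorem subdivisionHomotopy_succ_single {n : ℕ} (σ : Fin (n + 2) → Q) :
    subdivisionHomotopy R b (n + 1) (Finsupp.single σ 1) =
      cone R (n + 1) (b (n + 1) σ) (Finsupp.single σ 1 -
        subdivisionHomotopy R b n (tupleBoundary R Q n (Finsupp.single σ 1))) := by
  rw [subdivisionHomotopy, Finsupp.linearCombination_single, one_smul]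

/-- The boundary of the cone on the subdivided boundary is its base minus the cone on `∂ sd ∂σ`. By
induction the latter is `sd ∂∂σ = 0`; in the lowest degree the correction is the augmentation of a
boundary, again zero. -/
theorem tupleBoundary_subdivision {n : ℕ} (c : TupleChain R Q (n + 1)) :
    tupleBoundary R Q n (subdivision R b (n + 1) c) =
      subdivision R b n (tupleBoundary R Q n c) := by
  suffices h : tupleBoundary R Q n ∘ₗ subdivision R b (n + 1) =
      subdivision R b n ∘ₗ tupleBoundary R Q n from LinearMap.congr_fun h c
  refine linearMap_ext_single fun σ => ?_
  rw [LinearMap.comp_apply, LinearMap.comp_apply, subdivision_succ_single]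
  induction n with
  | zero => simp [tupleBoundary_cone_zero, subdivision, augmentation_tupleBoundary]
  | succ n ih =>
    have h : tupleBoundary R Q n ∘ₗ subdivision R b (n + 1) =
        subdivision R b n ∘ₗ tupleBoundary R Q n := linearMap_ext_single fun σ => by
      rw [LinearMap.comp_apply, LinearMap.comp_apply, subdivision_succ_single]
      exact ih (Finsupp.single σ 1) σ
    rw [tupleBoundary_cone]
    have h' := LinearMap.congr_fun h (tupleBoundary R Q (n + 1) (Finsupp.single σ 1))
    rw [LinearMap.comp_apply, LinearMap.comp_apply, tupleBoundary_tupleBoundary, map_zero] at h'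
    rw [h', map_zero, sub_zero]

theorem tupleBoundary_subdivisionHomotopy {n : ℕ} (c : TupleChain R Q (n + 1)) :
    tupleBoundary R Q (n + 1) (subdivisionHomotopy R b (n + 1) c) +
      subdivisionHomotopy R b n (tupleBoundary R Q n c) = c - subdivision R b (n + 1) c := by
  suffices h : tupleBoundary R Q (n + 1) ∘ₗ subdivisionHomotopy R b (n + 1) +
      subdivisionHomotopy R b n ∘ₗ tupleBoundary R Q n =
        LinearMap.id - subdivision R b (n + 1) from LinearMap.congr_fun h c
  refine linearMap_ext_single fun σ => ?_
  simp only [LinearMap.add_apply, LinearMap.comp_apply, LinearMap.sub_apply, LinearMap.id_apply]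
  induction n with
  | zero =>
    rw [subdivisionHomotopy_succ_single, subdivision_succ_single, tupleBoundary_cone]
    simp [subdivisionHomotopy, subdivision]
  | succ n ih =>
    have h : tupleBoundary R Q (n + 1) ∘ₗ subdivisionHomotopy R b (n + 1) +
        subdivisionHomotopy R b n ∘ₗ tupleBoundary R Q n =
          LinearMap.id - subdivision R b (n + 1) := linearMap_ext_single fun σ => by
      simpa using ih (Finsupp.single σ 1) σ
    have h' := LinearMap.congr_fun h (tupleBoundary R Q (n + 1) (Finsupp.single σ 1))
    simp only [LinearMap.add_apply, LinearMap.comp_apply, LinearMap.sub_apply, LinearMap.id_apply,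
      tupleBoundary_tupleBoundary, map_zero, add_zero] at h'
    rw [subdivisionHomotopy_succ_single, subdivision_succ_single, tupleBoundary_cone, map_sub, h',
      sub_sub_cancel]
    abel

theorem tupleBoundary_subdivision_pow {n : ℕ} (m : ℕ) (c : TupleChain R Q (n + 1)) :
    tupleBoundary R Q n ((subdivision R b (n + 1) ^ m) c) =
      (subdivision R b n ^ m) (tupleBoundary R Q n c) := by
  induction m with
  | zero => simp
  | succ m ih =>
    rw [pow_succ', pow_succ', Module.End.mul_apply, Module.End.mul_apply,
      tupleBoundary_subdivision, ih]

/-- The one-step homotopy identity applied to the successive subdivisions `sd^i c` telescopes. -/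
theorem tupleBoundary_subdivisionHomotopyIter {n : ℕ} (m : ℕ) (c : TupleChain R Q (n + 1)) :
    tupleBoundary R Q (n + 1) (subdivisionHomotopyIter R b (n + 1) m c) +
      subdivisionHomotopyIter R b n m (tupleBoundary R Q n c) =
        c - (subdivision R b (n + 1) ^ m) c := by
  simp only [subdivisionHomotopyIter, LinearMap.sum_apply, LinearMap.comp_apply, map_sum]
  rw [← Finset.sum_add_distrib]
  induction m with
  | zero => simp
  | succ m ih =>
    rw [Finset.sum_range_succ, ih, ← tupleBoundary_subdivision_pow,
      tupleBoundary_subdivisionHomotopy, pow_succ', Module.End.mul_apply, sub_add_sub_cancel]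

theorem subdivisionHomotopyIter_zero (m : ℕ) : subdivisionHomotopyIter R b 0 m = 0 := by
  simp [subdivisionHomotopyIter, subdivisionHomotopy]

/-! ### Naturality -/

section Naturality

variable {f : Q → Q'} (hf : ∀ n σ, f (b n σ) = b' n (f ∘ σ))

include hf

theorem subdivision_mapTuples {n : ℕ} (c : TupleChain R Q n) :
    subdivision R b' n (mapTuples R f n c) = mapTuples R f n (subdivision R b n c) := by
  induction n with
  | zero => rfl
  | succ n ih =>
    suffices h : subdivision R b' (n + 1) ∘ₗ mapTuples R f (n + 1) =
        mapTuples R f (n + 1) ∘ₗ subdivision R b (n + 1) from LinearMap.congr_fun h c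
    refine linearMap_ext_single fun σ => ?_
    rw [LinearMap.comp_apply, LinearMap.comp_apply, mapTuples_single, subdivision_succ_single,
      subdivision_succ_single, ← cone_mapTuples, hf, ← ih, ← tupleBoundary_mapTuples,
      mapTuples_single]

theorem subdivisionHomotopy_mapTuples {n : ℕ} (c : TupleChain R Q n) :
    subdivisionHomotopy R b' n (mapTuples R f n c) =
      mapTuples R f (n + 1) (subdivisionHomotopy R b n c) := by
  induction n with
  | zero => simp [subdivisionHomotopy]
  | succ n ih =>
    suffices h : subdivisionHomotopy R b' (n + 1) ∘ₗ mapTuples R f (n + 1) =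
        mapTuples R f (n + 2) ∘ₗ subdivisionHomotopy R b (n + 1) from LinearMap.congr_fun h c
    refine linearMap_ext_single fun σ => ?_
    rw [LinearMap.comp_apply, LinearMap.comp_apply, mapTuples_single,
      subdivisionHomotopy_succ_single, subdivisionHomotopy_succ_single, ← cone_mapTuples, hf,
      map_sub (mapTuples R f (n + 1)), ← ih, ← tupleBoundary_mapTuples, mapTuples_single]

theorem subdivision_pow_mapTuples {n : ℕ} (m : ℕ) (c : TupleChain R Q n) :
    (subdivision R b' n ^ m) (mapTuples R f n c) =
      mapTuples R f n ((subdivision R b n ^ m) c) := by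
  induction m with
  | zero => simp
  | succ m ih =>
    rw [pow_succ', pow_succ', Module.End.mul_apply, Module.End.mul_apply, ih,
      subdivision_mapTuples hf]

theorem subdivisionHomotopyIter_mapTuples {n : ℕ} (m : ℕ) (c : TupleChain R Q n) :
    subdivisionHomotopyIter R b' n m (mapTuples R f n c) =
      mapTuples R f (n + 1) (subdivisionHomotopyIter R b n m c) := by
  simp only [subdivisionHomotopyIter, LinearMap.sum_apply, LinearMap.comp_apply, map_sum]
  refine Finset.sum_congr rfl fun i _ => ?_
  rw [← subdivisionHomotopy_mapTuples hf]
  rw [subdivision_pow_mapTuples hf]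

end Naturality

/-! ### Supports -/

theorem subdivision_mem_tupleChainsIn {A : Set Q}
    (hA : ∀ n (σ : Fin (n + 1) → Q), Set.range σ ⊆ A → b n σ ∈ A) {n : ℕ} {c : TupleChain R Q n}
    (hc : c ∈ tupleChainsIn R A n) : subdivision R b n c ∈ tupleChainsIn R A n := by
  induction n with
  | zero => exact hc
  | succ n ih =>
    refine map_mem_of_mem_supported _ _ (fun σ hσ => ?_) hc
    rw [subdivision_succ_single]
    exact cone_mem_tupleChainsIn (hA _ _ hσ)
      (ih (tupleBoundary_mem_tupleChainsIn (single_one_mem_supported hσ)))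

theorem subdivisionHomotopy_mem_tupleChainsIn {A : Set Q}
    (hA : ∀ n (σ : Fin (n + 1) → Q), Set.range σ ⊆ A → b n σ ∈ A) {n : ℕ} {c : TupleChain R Q n}
    (hc : c ∈ tupleChainsIn R A n) : subdivisionHomotopy R b n c ∈ tupleChainsIn R A (n + 1) := by
  induction n with
  | zero => simp [subdivisionHomotopy]
  | succ n ih =>
    refine map_mem_of_mem_supported _ _ (fun σ hσ => ?_) hc
    rw [subdivisionHomotopy_succ_single]
    exact cone_mem_tupleChainsIn (hA _ _ hσ) (sub_mem (single_one_mem_supported hσ)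
      (ih (tupleBoundary_mem_tupleChainsIn (single_one_mem_supported hσ))))

variable (b) in
/-- The tuples contained in a member of `𝒱` together with all the barycentres of their iterated
subdivisions. -/
def subdivisionSmall (𝒱 : Set (Set Q)) (n : ℕ) : Set (Fin (n + 1) → Q) :=
  {τ | ∃ A : Set Q, (∀ n (σ : Fin (n + 1) → Q), Set.range σ ⊆ A → b n σ ∈ A) ∧
    Set.range τ ⊆ A ∧ ∃ V ∈ 𝒱, A ⊆ V}

theorem subdivision_mem_small {𝒱 : Set (Set Q)} {n : ℕ} {c : TupleChain R Q n}
    (hc : c ∈ Finsupp.supported R R (subdivisionSmall b 𝒱 n)) :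
    subdivision R b n c ∈ Finsupp.supported R R (subdivisionSmall b 𝒱 n) := by
  refine map_mem_of_mem_supported _ _ ?_ hc
  rintro σ ⟨A, hA, hσ, hV⟩
  exact Finsupp.supported_mono (s := {τ | Set.range τ ⊆ A}) (t := subdivisionSmall b 𝒱 _)
    (fun τ hτ => ⟨A, hA, hτ, hV⟩)
    (subdivision_mem_tupleChainsIn hA (single_one_mem_supported hσ))

theorem subdivisionHomotopy_mem_small {𝒱 : Set (Set Q)} {n : ℕ} {c : TupleChain R Q n}
    (hc : c ∈ Finsupp.supported R R (subdivisionSmall b 𝒱 n)) :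
    subdivisionHomotopy R b n c ∈ Finsupp.supported R R (subdivisionSmall b 𝒱 (n + 1)) := by
  refine map_mem_of_mem_supported _ _ ?_ hc
  rintro σ ⟨A, hA, hσ, hV⟩
  exact Finsupp.supported_mono (s := {τ | Set.range τ ⊆ A}) (t := subdivisionSmall b 𝒱 _)
    (fun τ hτ => ⟨A, hA, hτ, hV⟩)
    (subdivisionHomotopy_mem_tupleChainsIn hA (single_one_mem_supported hσ))

theorem subdivision_pow_mem_small {𝒱 : Set (Set Q)} {n m m' : ℕ} (hm : m ≤ m')
    {c : TupleChain R Q n}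
    (hc : (subdivision R b n ^ m) c ∈ Finsupp.supported R R (subdivisionSmall b 𝒱 n)) :
    (subdivision R b n ^ m') c ∈ Finsupp.supported R R (subdivisionSmall b 𝒱 n) := by
  induction m', hm using Nat.le_induction with
  | base => exact hc
  | succ k _ ih =>
    rw [pow_succ', Module.End.mul_apply]
    exact subdivision_mem_small ih

/-- The difference consists of the homotopy applied to `sd^i c` with `m ≤ i < m'`, and these
subdivisions are already small. This permits subdividing a simplex more often than its faces. -/
theorem subdivisionHomotopyIter_sub_mem_small {𝒱 : Set (Set Q)} {n m m' : ℕ} (hm : m ≤ m')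
    {c : TupleChain R Q n}
    (hc : (subdivision R b n ^ m) c ∈ Finsupp.supported R R (subdivisionSmall b 𝒱 n)) :
    subdivisionHomotopyIter R b n m' c - subdivisionHomotopyIter R b n m c ∈
      Finsupp.supported R R (subdivisionSmall b 𝒱 (n + 1)) := by
  induction m', hm using Nat.le_induction with
  | base => rw [sub_self]; exact zero_mem _
  | succ k hk ih =>
    rw [subdivisionHomotopyIter, Finset.sum_range_succ, LinearMap.add_apply, add_sub_right_comm]
    exact add_mem ih (subdivisionHomotopy_mem_small (subdivision_pow_mem_small hk hc))

/-! ### The mesh -/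

section Mesh

variable {Q : Type*} [PseudoMetricSpace Q] {b : ∀ n, (Fin (n + 1) → Q) → Q}
  (hball : ∀ n (σ : Fin (n + 1) → Q) x r, (∀ i, dist (σ i) x ≤ r) → dist (b n σ) x ≤ r)
  (hmesh : ∀ n (σ : Fin (n + 1) → Q) δ, (∀ i j, dist (σ i) (σ j) ≤ δ) →
    ∀ j, dist (b n σ) (σ j) ≤ n / (n + 1) * δ)

include hball hmesh

/-- An edge of the subdivision either lies in a subdivided face, where induction applies, or starts
at the barycentre. In the second case its other end lies in a ball about the barycentre that
contains all vertices and, by `hball`, all points produced by subdividing the faces. -/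
theorem subdivision_single_mesh {n : ℕ} {σ : Fin (n + 1) → Q} {δ : ℝ}
    (hσ : ∀ i j, dist (σ i) (σ j) ≤ δ) :
    subdivision R b n (Finsupp.single σ 1) ∈
      Finsupp.supported R R {τ | ∀ i j, dist (τ i) (τ j) ≤ n / (n + 1) * δ} := by
  have hδ : 0 ≤ δ := dist_nonneg.trans (hσ 0 0)
  induction n with
  | zero =>
    refine single_one_mem_supported fun i j => ?_
    rw [Fin.fin_one_eq_zero i, Fin.fin_one_eq_zero j, dist_self]
    simp
  | succ n ih =>
    set η : ℝ := ((n + 1 : ℕ) : ℝ) / ((n + 1 : ℕ) + 1) * δ with hη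
    have hη0 : 0 ≤ η := by positivity
    have hle : (n : ℝ) / (n + 1) * δ ≤ η := by
      refine mul_le_mul_of_nonneg_right ?_ hδ
      rw [div_le_div_iff₀ (by positivity) (by positivity)]
      push_cast
      nlinarith
    have hb := hmesh _ σ δ hσ
    rw [subdivision_succ_single]
    refine mapDomain_mem_supported (s := {τ | (∀ i j, dist (τ i) (τ j) ≤ η) ∧
      Set.range τ ⊆ Metric.closedBall (b (n + 1) σ) η}) _ ?_ ?_
    · rintro τ ⟨hτ, hτb⟩ i j
      refine Fin.cases ?_ (fun i => ?_) i <;> refine Fin.cases ?_ (fun j => ?_) j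
      · simpa using hη0
      · simpa [dist_comm] using hτb ⟨j, rfl⟩
      · simpa using hτb ⟨i, rfl⟩
      · simpa using hτ i j
    · rw [tupleBoundary_single, map_sum]
      refine Submodule.sum_mem _ fun i _ => ?_
      rw [map_zsmul]
      refine zsmul_mem ?_ _
      have h1 := ih (σ := σ ∘ i.succAbove) fun j k => hσ _ _
      have h2 : subdivision R b n (Finsupp.single (σ ∘ i.succAbove) 1) ∈
          tupleChainsIn R (Metric.closedBall (b (n + 1) σ) η) n := by
        refine subdivision_mem_tupleChainsIn (fun k ρ hρ => ?_) (single_one_mem_supported ?_)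
        · exact hball k ρ _ _ fun i => hρ ⟨i, rfl⟩
        · rintro _ ⟨j, rfl⟩
          rw [Metric.mem_closedBall, dist_comm]
          exact hb _
      exact fun τ hτ => ⟨fun j k => (h1 hτ j k).trans hle, h2 hτ⟩

theorem subdivision_pow_single_mesh {n : ℕ} {σ : Fin (n + 1) → Q} {δ : ℝ}
    (hσ : ∀ i j, dist (σ i) (σ j) ≤ δ) (m : ℕ) :
    (subdivision R b n ^ m) (Finsupp.single σ 1) ∈
      Finsupp.supported R R {τ | ∀ i j, dist (τ i) (τ j) ≤ ((n : ℝ) / (n + 1)) ^ m * δ} := by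
  induction m with
  | zero => exact single_one_mem_supported (by simpa using hσ)
  | succ m ih =>
    rw [pow_succ' (subdivision R b n), Module.End.mul_apply]
    refine map_mem_of_mem_supported _ _ (fun τ hτ => ?_) ih
    have := subdivision_single_mesh (R := R) hball hmesh hτ
    rwa [← mul_assoc, ← pow_succ'] at this

/-- The mesh shrinks geometrically and eventually falls below a Lebesgue number of the cover. The
set closed under barycentres demanded by `subdivisionSmall` is a closed ball about a vertex of the
subdivided tuple. -/
theorem exists_subdivision_pow_mem_small [CompactSpace Q] {𝒱 : Set (Set Q)}
    (ho : ∀ V ∈ 𝒱, IsOpen V) (hc : ∀ x, ∃ V ∈ 𝒱, x ∈ V) {n : ℕ} (σ : Fin (n + 1) → Q) :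
    ∃ m, (subdivision R b n ^ m) (Finsupp.single σ 1) ∈
      Finsupp.supported R R (subdivisionSmall b 𝒱 n) := by
  obtain ⟨ε, hε, h⟩ := lebesgue_number_lemma_of_metric_sUnion (s := Set.univ) (c := 𝒱)
    isCompact_univ ho fun x _ => Set.mem_sUnion.2 (hc x)
  set δ := Metric.diam (Set.range σ)
  have hσ : ∀ i j, dist (σ i) (σ j) ≤ δ := fun i j =>
    Metric.dist_le_diam_of_mem (Set.finite_range σ).isBounded ⟨i, rfl⟩ ⟨j, rfl⟩
  have hlim : Filter.Tendsto (fun m : ℕ => ((n : ℝ) / (n + 1)) ^ m * δ) Filter.atTop (nhds 0) := by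
    have := (tendsto_pow_atTop_nhds_zero_of_lt_one (r := (n : ℝ) / (n + 1)) (by positivity)
      (by rw [div_lt_one (by positivity)]; linarith)).mul_const δ
    simpa using this
  obtain ⟨m, hm⟩ := (hlim.eventually (gt_mem_nhds hε)).exists
  refine ⟨m, Finsupp.supported_mono (fun τ hτ => ?_)
    (subdivision_pow_single_mesh hball hmesh hσ m)⟩
  obtain ⟨V, hV, hb⟩ := h (τ 0) trivial
  refine ⟨Metric.closedBall (τ 0) (((n : ℝ) / (n + 1)) ^ m * δ), fun k ρ hρ => ?_, ?_, V, hV,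
    (Metric.closedBall_subset_ball hm).trans hb⟩
  · exact hball k ρ _ _ fun i => hρ ⟨i, rfl⟩
  · rintro _ ⟨i, rfl⟩
    exact hτ i 0

end Mesh

end Subdivision

/-! ### Barycentres in the standard simplex -/

section Simplex

variable {ι κ : Type*} [Fintype ι] [Fintype κ]

/-- The barycentre of a tuple of points of the standard simplex. -/
noncomputable def simplexBarycenter (n : ℕ) (σ : Fin (n + 1) → stdSimplex ℝ ι) :
    stdSimplex ℝ ι :=
  ⟨∑ i, ((n : ℝ) + 1)⁻¹ • (σ i : ι → ℝ),
    (convex_stdSimplex ℝ ι).sum_mem (fun _ _ => by positivity)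
      (by simp [mul_inv_cancel₀ (show (n : ℝ) + 1 ≠ 0 by positivity)]) fun i _ => (σ i).2⟩

theorem map_simplexBarycenter (f : ι → κ) (n : ℕ) (σ : Fin (n + 1) → stdSimplex ℝ ι) :
    stdSimplex.map f (simplexBarycenter n σ) = simplexBarycenter n (stdSimplex.map f ∘ σ) := by
  apply Subtype.ext
  change FunOnFinite.linearMap ℝ ℝ f (∑ i, ((n : ℝ) + 1)⁻¹ • (σ i : ι → ℝ)) =
    ∑ i, ((n : ℝ) + 1)⁻¹ • FunOnFinite.linearMap ℝ ℝ f (σ i)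
  simp only [map_sum, map_smul]

theorem dist_simplexBarycenter_le (n : ℕ) (σ : Fin (n + 1) → stdSimplex ℝ ι) (x : stdSimplex ℝ ι)
    (r : ℝ) (h : ∀ i, dist (σ i) x ≤ r) : dist (simplexBarycenter n σ) x ≤ r :=
  (convex_closedBall (x : ι → ℝ) r).sum_mem (w := fun _ => ((n : ℝ) + 1)⁻¹)
    (z := fun i => (σ i : ι → ℝ)) (t := Finset.univ) (fun _ _ => by positivity)
    (by simp [mul_inv_cancel₀ (show (n : ℝ) + 1 ≠ 0 by positivity)]) fun i _ => h i

theorem dist_simplexBarycenter_vertex_le (n : ℕ) (σ : Fin (n + 1) → stdSimplex ℝ ι) (δ : ℝ)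
    (h : ∀ i j, dist (σ i) (σ j) ≤ δ) (j : Fin (n + 1)) :
    dist (simplexBarycenter n σ) (σ j) ≤ n / (n + 1) * δ := by
  have hn : (n : ℝ) + 1 ≠ 0 := by positivity
  -- One of the `n + 1` summands is zero, which is where the factor `n / (n + 1)` comes from.
  have h1 : (simplexBarycenter n σ).1 - (σ j).1 =
      ((n : ℝ) + 1)⁻¹ • ∑ i, ((σ i).1 - (σ j).1) := by
    rw [Finset.sum_sub_distrib, smul_sub, Finset.smul_sum, Finset.sum_const, Finset.card_univ,
      Fintype.card_fin, ← Nat.cast_smul_eq_nsmul ℝ, smul_smul, Nat.cast_add, Nat.cast_one,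
      inv_mul_cancel₀ hn, one_smul]
    rfl
  have h2 : ‖∑ i, ((σ i).1 - (σ j).1)‖ ≤ n * δ := by
    refine (norm_sum_le _ _).trans ?_
    rw [← Finset.add_sum_erase _ _ (Finset.mem_univ j), sub_self, norm_zero, zero_add]
    refine (Finset.sum_le_card_nsmul _ _ δ fun i _ => ?_).trans ?_
    · rw [← dist_eq_norm]
      exact h i j
    · simp
  rw [Subtype.dist_eq, dist_eq_norm, h1, norm_smul, Real.norm_of_nonneg (by positivity),
    div_mul_eq_mul_div, div_eq_inv_mul]
  exact mul_le_mul_of_nonneg_left h2 (by positivity)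

end Simplex

/-! ## Singular chains -/

section SingularChains

variable (R : Type v) [Ring R] {X Y : Type*} [TopologicalSpace X] [TopologicalSpace Y]

/-- Finite `R`-linear combinations of singular `n`-simplices of `X`. -/
abbrev SingularChain (X : Type*) [TopologicalSpace X] (n : ℕ) : Type _ :=
  C(stdSimplex ℝ (Fin (n + 1)), X) →₀ R

/-- The `i`-th face inclusion of standard simplices. -/
noncomputable def simplexFace {n : ℕ} (i : Fin (n + 2)) :
    C(stdSimplex ℝ (Fin (n + 1)), stdSimplex ℝ (Fin (n + 2))) :=
  ⟨stdSimplex.map i.succAbove, stdSimplex.continuous_map _⟩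

/-- The `i`-th face of a singular simplex. -/
noncomputable def singularFace {n : ℕ} (i : Fin (n + 2))
    (s : C(stdSimplex ℝ (Fin (n + 2)), X)) : C(stdSimplex ℝ (Fin (n + 1)), X) :=
  s.comp (simplexFace i)

/-- The boundary of singular chains. -/
noncomputable def singularBoundary (X : Type*) [TopologicalSpace X] (n : ℕ) :
    SingularChain R X (n + 1) →ₗ[R] SingularChain R X n :=
  faceBoundary (n := n) R singularFace

variable {R}

theorem singularBoundary_single {n : ℕ} (s : C(stdSimplex ℝ (Fin (n + 2)), X)) (r : R) :
    singularBoundary R X n (Finsupp.single s r) =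
      ∑ i : Fin (n + 2), (-1 : ℤ) ^ (i : ℕ) • Finsupp.single (singularFace i s) r :=
  faceBoundary_single _ _ _

theorem singularBoundary_singularBoundary {n : ℕ} (c : SingularChain R X (n + 2)) :
    singularBoundary R X n (singularBoundary R X (n + 1) c) = 0 := by
  refine faceBoundary_faceBoundary (n := n) singularFace singularFace (fun i j s => ?_) c
  ext t
  simp only [singularFace, simplexFace, ContinuousMap.comp_apply, ContinuousMap.coe_mk,
    stdSimplex.map_comp_apply]
  congr 2
  funext k
  exact Fin.succAbove_succAbove_succAbove_predAbove i j k

/-- The singular chains carried by `A ⊆ X`. -/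
abbrev singularChainsIn (R : Type v) [Ring R] (A : Set X) (n : ℕ) :
    Submodule R (SingularChain R X n) :=
  Finsupp.supported R R {s | Set.range s ⊆ A}

/-- The map of singular chains induced by a continuous map. -/
noncomputable def mapSingular (R : Type v) [Ring R] (f : C(X, Y)) (n : ℕ) :
    SingularChain R X n →ₗ[R] SingularChain R Y n :=
  Finsupp.lmapDomain R R f.comp

theorem mapSingular_single {n : ℕ} (f : C(X, Y)) (s : C(stdSimplex ℝ (Fin (n + 1)), X)) (r : R) :
    mapSingular R f n (Finsupp.single s r) = Finsupp.single (f.comp s) r := by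
  simp [mapSingular, Finsupp.mapDomain_single]

theorem singularBoundary_mapSingular {n : ℕ} (f : C(X, Y)) (c : SingularChain R X (n + 1)) :
    singularBoundary R Y n (mapSingular R f (n + 1) c) =
      mapSingular R f n (singularBoundary R X n c) :=
  faceBoundary_mapDomain (n := n) _ _ f.comp f.comp (fun _ _ => rfl) c

theorem augmentation_mapSingular {n : ℕ} (f : C(X, Y)) (c : SingularChain R X n) :
    augmentation R _ (mapSingular R f n c) = augmentation R _ c :=
  augmentation_mapDomain _ c

/-- A chain is a reduced cycle if its boundary, or its augmentation in degree zero, vanishes. -/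
def IsReducedCycle : ∀ {n : ℕ}, SingularChain R X n → Prop
  | 0, c => augmentation R _ c = 0
  | n + 1, c => singularBoundary R X n c = 0

end SingularChains

/-! ## Subdividing singular chains into small tuples -/

section SmallTuples

variable (R : Type v) [Ring R] {X : Type*} [TopologicalSpace X]

/-- The tuple of vertices of the standard simplex. -/
noncomputable def simplexVertices (n : ℕ) : Fin (n + 1) → stdSimplex ℝ (Fin (n + 1)) :=
  fun i => stdSimplex.vertex i

theorem simplexVertices_comp_succAbove {n : ℕ} (i : Fin (n + 2)) :
    simplexVertices (n + 1) ∘ i.succAbove = simplexFace i ∘ simplexVertices n :=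
  funext fun k => (stdSimplex.map_vertex (S := ℝ) i.succAbove k).symm

/-- The map taking a singular simplex to its tuple of vertices. -/
noncomputable def verticesMap (X : Type*) [TopologicalSpace X] (n : ℕ) :
    SingularChain R X n →ₗ[R] TupleChain R X n :=
  Finsupp.lmapDomain R R fun s => s ∘ simplexVertices n

/-- The image in `X` of the homotopy between the fundamental simplex and its `m`-fold subdivision,
where `m` depends on the singular simplex. -/
noncomputable def smallHomotopy (m : ∀ n, C(stdSimplex ℝ (Fin (n + 1)), X) → ℕ) (n : ℕ) :
    SingularChain R X n →ₗ[R] TupleChain R X (n + 1) :=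
  Finsupp.linearCombination R fun s => mapTuples R s (n + 1)
    (subdivisionHomotopyIter R (Q := stdSimplex ℝ (Fin (n + 1))) simplexBarycenter n (m n s)
      (Finsupp.single (simplexVertices n) 1))

/-- The chain map replacing a singular simplex `s` by the vertices of the simplices of its
`m s`-fold subdivision, corrected near the faces of `s` that are subdivided less often. -/
noncomputable def smallTuples (m : ∀ n, C(stdSimplex ℝ (Fin (n + 1)), X) → ℕ) :
    ∀ n, SingularChain R X n →ₗ[R] TupleChain R X n
  | 0 => verticesMap R X 0
  | n + 1 => verticesMap R X (n + 1) - tupleBoundary R X (n + 1) ∘ₗ smallHomotopy R m (n + 1) -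
      smallHomotopy R m n ∘ₗ singularBoundary R X n

variable {R}

theorem verticesMap_single {n : ℕ} (s : C(stdSimplex ℝ (Fin (n + 1)), X)) (r : R) :
    verticesMap R X n (Finsupp.single s r) = Finsupp.single (s ∘ simplexVertices n) r := by
  simp [verticesMap, Finsupp.mapDomain_single]

theorem smallHomotopy_single (m : ∀ n, C(stdSimplex ℝ (Fin (n + 1)), X) → ℕ) {n : ℕ}
    (s : C(stdSimplex ℝ (Fin (n + 1)), X)) :
    smallHomotopy R m n (Finsupp.single s 1) = mapTuples R s (n + 1)
      (subdivisionHomotopyIter R (Q := stdSimplex ℝ (Fin (n + 1))) simplexBarycenter n (m n s)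
        (Finsupp.single (simplexVertices n) 1)) := by
  rw [smallHomotopy, Finsupp.linearCombination_single, one_smul]

theorem smallHomotopy_zero (m : ∀ n, C(stdSimplex ℝ (Fin (n + 1)), X) → ℕ) :
    smallHomotopy R m 0 = 0 :=
  linearMap_ext_single fun s => by
    rw [smallHomotopy_single, subdivisionHomotopyIter_zero]
    simp

theorem tupleBoundary_verticesMap {n : ℕ} (c : SingularChain R X (n + 1)) :
    tupleBoundary R X n (verticesMap R X (n + 1) c) =
      verticesMap R X n (singularBoundary R X n c) := by
  refine faceBoundary_mapDomain (n := n) singularFace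
    (fun (i : Fin (n + 2)) (x : Fin (n + 2) → X) => x ∘ i.succAbove)
    (fun s : C(stdSimplex ℝ (Fin (n + 2)), X) =>
    s ∘ simplexVertices (n + 1)) (fun s => s ∘ simplexVertices n) (fun i s => ?_) c
  rw [Function.comp_assoc, simplexVertices_comp_succAbove]
  rfl

/-- `smallTuples` is the vertex map minus `∂T + T∂` with `T = smallHomotopy`, hence a chain map for
any choice of `m`, even one that is incompatible with faces. -/
theorem tupleBoundary_smallTuples (m : ∀ n, C(stdSimplex ℝ (Fin (n + 1)), X) → ℕ) {n : ℕ}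
    (c : SingularChain R X (n + 1)) :
    tupleBoundary R X n (smallTuples R m (n + 1) c) =
      smallTuples R m n (singularBoundary R X n c) := by
  cases n with
  | zero =>
    simp [smallTuples, smallHomotopy_zero, tupleBoundary_verticesMap, tupleBoundary_tupleBoundary]
  | succ n =>
    simp [smallTuples, tupleBoundary_verticesMap, tupleBoundary_tupleBoundary,
      singularBoundary_singularBoundary]

theorem singularFace_comp {n : ℕ} (i : Fin (n + 2)) (s : C(stdSimplex ℝ (Fin (n + 2)), X)) :
    (singularFace i s : stdSimplex ℝ (Fin (n + 1)) → X) = s ∘ simplexFace i := rfl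

theorem mapTuples_comp {X Y Z : Type*} (g : Y → Z) (f : X → Y) {n : ℕ} (c : TupleChain R X n) :
    mapTuples R (g ∘ f) n c = mapTuples R g n (mapTuples R f n c) := by
  simp only [mapTuples, Finsupp.lmapDomain_apply, ← Finsupp.mapDomain_comp]
  rfl

/-- The homotopy identity cancels the unsubdivided vertex tuple. What remains is the subdivision of
`s` and, on each face, a correction for the discrepancy between the numbers of iterations for `s`
and for that face; in this form smallness is visible. -/
theorem smallTuples_succ_single (m : ∀ n, C(stdSimplex ℝ (Fin (n + 1)), X) → ℕ) {n : ℕ}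
    (s : C(stdSimplex ℝ (Fin (n + 2)), X)) :
    smallTuples R m (n + 1) (Finsupp.single s 1) =
      mapTuples R s (n + 1)
        ((subdivision R (Q := stdSimplex ℝ (Fin (n + 2))) simplexBarycenter (n + 1) ^ m (n + 1) s)
          (Finsupp.single (simplexVertices (n + 1)) 1)) +
      ∑ i : Fin (n + 2), (-1 : ℤ) ^ (i : ℕ) • mapTuples R (singularFace i s) (n + 1)
        (subdivisionHomotopyIter R (Q := stdSimplex ℝ (Fin (n + 1))) simplexBarycenter n
            (m (n + 1) s) (Finsupp.single (simplexVertices n) 1) -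
          subdivisionHomotopyIter R (Q := stdSimplex ℝ (Fin (n + 1))) simplexBarycenter n
            (m n (singularFace i s)) (Finsupp.single (simplexVertices n) 1)) := by
  have h1 : subdivisionHomotopyIter R (Q := stdSimplex ℝ (Fin (n + 2))) simplexBarycenter n
      (m (n + 1) s) (tupleBoundary R _ n (Finsupp.single (simplexVertices (n + 1)) 1)) =
      ∑ i : Fin (n + 2), (-1 : ℤ) ^ (i : ℕ) • mapTuples R (simplexFace i) (n + 1)
        (subdivisionHomotopyIter R (Q := stdSimplex ℝ (Fin (n + 1))) simplexBarycenter n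
          (m (n + 1) s) (Finsupp.single (simplexVertices n) 1)) := by
    rw [tupleBoundary_single, map_sum]
    refine Finset.sum_congr rfl fun i _ => ?_
    rw [map_zsmul, simplexVertices_comp_succAbove, ← mapTuples_single,
      subdivisionHomotopyIter_mapTuples (f := simplexFace i) (b := simplexBarycenter)
        (b' := simplexBarycenter) fun n σ => map_simplexBarycenter i.succAbove n σ]
  have h2 := tupleBoundary_subdivisionHomotopyIter (R := R) (b := simplexBarycenter) (m (n + 1) s)
    (Finsupp.single (simplexVertices (n + 1)) 1)
  rw [← eq_sub_iff_add_eq] at h2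
  rw [smallTuples, LinearMap.sub_apply, LinearMap.sub_apply, LinearMap.comp_apply,
    LinearMap.comp_apply, verticesMap_single, smallHomotopy_single, tupleBoundary_mapTuples, h2,
    map_sub, map_sub, mapTuples_single, h1, singularBoundary_single, map_sum, map_sum]
  simp only [map_zsmul, smallHomotopy_single, map_sub, smul_sub, Finset.sum_sub_distrib,
    singularFace_comp, mapTuples_comp]
  abel

/-- Singular chains can be replaced by chains on tuples which are small with respect to a given
open cover, without enlarging supports. -/
theorem exists_smallTuples (R : Type v) [Ring R] {𝒰 : Set (Set X)} (ho : ∀ U ∈ 𝒰, IsOpen U)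
    (hc : ∀ x, ∃ U ∈ 𝒰, x ∈ U) :
    ∃ P : ∀ n, SingularChain R X n →ₗ[R] TupleChain R X n,
      (∀ s : C(stdSimplex ℝ (Fin 1), X),
        P 0 (Finsupp.single s 1) = Finsupp.single (s ∘ simplexVertices 0) 1) ∧
      (∀ n c, tupleBoundary R X n (P (n + 1) c) = P n (singularBoundary R X n c)) ∧
      ∀ n (s : C(stdSimplex ℝ (Fin (n + 1)), X)), P n (Finsupp.single s 1) ∈ Finsupp.supported R R
        {τ | Set.range τ ⊆ Set.range s ∧ ∃ U ∈ 𝒰, Set.range τ ⊆ U} := by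
  have hex : ∀ n (s : C(stdSimplex ℝ (Fin (n + 1)), X)), ∃ m,
      (subdivision R (Q := stdSimplex ℝ (Fin (n + 1))) simplexBarycenter n ^ m)
        (Finsupp.single (simplexVertices n) 1) ∈ Finsupp.supported R R
          (subdivisionSmall simplexBarycenter ((s ⁻¹' ·) '' 𝒰) n) := fun n s => by
    refine exists_subdivision_pow_mem_small dist_simplexBarycenter_le
      dist_simplexBarycenter_vertex_le ?_ (fun x => ?_) _
    · rintro _ ⟨U, hU, rfl⟩
      exact (ho U hU).preimage s.continuous
    · obtain ⟨U, hU, hx⟩ := hc (s x)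
      exact ⟨_, ⟨U, hU, rfl⟩, hx⟩
  choose m₀ hm₀ using hex
  -- The numbers of iterations are enlarged so that no face is subdivided more often than the
  -- simplex; the corrections on the faces then involve only subdivisions that are already small.
  obtain ⟨m, hm, hmono⟩ : ∃ m : ∀ n, C(stdSimplex ℝ (Fin (n + 1)), X) → ℕ,
      (∀ n s, m₀ n s ≤ m n s) ∧ ∀ n s i, m n (singularFace i s) ≤ m (n + 1) s := by
    refine ⟨fun n => Nat.rec (m₀ 0) (fun n f s => max (m₀ (n + 1) s)
      (Finset.univ.sup fun i => f (singularFace i s))) n, fun n s => ?_, fun n s i => ?_⟩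
    · cases n with
      | zero => exact le_rfl
      | succ n => exact le_max_left _ _
    · exact (Finset.le_sup (f := fun i => Nat.rec (motive := fun n =>
        C(stdSimplex ℝ (Fin (n + 1)), X) → ℕ) (m₀ 0) (fun n f s => max (m₀ (n + 1) s)
          (Finset.univ.sup fun i => f (singularFace i s))) n (singularFace i s))
        (Finset.mem_univ i)).trans (le_max_right _ _)
  have hmap : ∀ {k n : ℕ} (s : C(stdSimplex ℝ (Fin (k + 1)), X))
      {c : TupleChain R (stdSimplex ℝ (Fin (k + 1))) n},
      c ∈ Finsupp.supported R R (subdivisionSmall simplexBarycenter ((s ⁻¹' ·) '' 𝒰) n) →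
      mapTuples R s n c ∈ Finsupp.supported R R
        {τ | Set.range τ ⊆ Set.range s ∧ ∃ U ∈ 𝒰, Set.range τ ⊆ U} := by
    intro k n s c hc
    refine mapDomain_mem_supported _ ?_ hc
    rintro τ ⟨A, -, hτ, _, ⟨U, hU, rfl⟩, hA⟩
    refine ⟨Set.range_comp_subset_range _ _, U, hU, ?_⟩
    rw [Set.range_comp]
    exact Set.image_subset_iff.2 (hτ.trans hA)
  refine ⟨smallTuples R m, fun s => verticesMap_single s 1,
    fun n c => tupleBoundary_smallTuples m c, fun n s => ?_⟩
  cases n with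
  | zero =>
    rw [smallTuples, verticesMap_single, ← mapTuples_single]
    refine hmap s ?_
    -- Subdivision is the identity in degree zero, so all its powers agree.
    convert hm₀ 0 s
    have : ∀ k, (subdivision R (Q := stdSimplex ℝ (Fin 1)) simplexBarycenter 0) ^ k = 1 :=
      fun k => one_pow k
    rw [this]
    rfl
  | succ n =>
    rw [smallTuples_succ_single]
    refine add_mem (hmap s (subdivision_pow_mem_small (hm _ _) (hm₀ _ _)))
      (Submodule.sum_mem _ fun i _ => zsmul_mem ?_ _)
    have hsub : {τ : Fin (n + 2) → X | Set.range τ ⊆ Set.range (singularFace i s) ∧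
        ∃ U ∈ 𝒰, Set.range τ ⊆ U} ⊆
        {τ | Set.range τ ⊆ Set.range s ∧ ∃ U ∈ 𝒰, Set.range τ ⊆ U} := fun τ hτ =>
      ⟨hτ.1.trans (Set.range_comp_subset_range (simplexFace i) s), hτ.2⟩
    exact Finsupp.supported_mono hsub (hmap (singularFace i s)
      (subdivisionHomotopyIter_sub_mem_small (hmono n s i)
        (subdivision_pow_mem_small (hm _ _) (hm₀ _ _))))

end SmallTuples

/-! ## Homology of complexes of modules in terms of elements -/

section Elements

variable {R : Type u} [Ring R] {ι : Type*} {c : ComplexShape ι}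
  {K L : HomologicalComplex (ModuleCat.{v} R) c}

theorem exists_cycle {i j : ι} (hj : c.next i = j) (x : K.X i) (hx : K.d i j x = 0) :
    ∃ z : K.cycles i, K.iCycles i z = x := by
  have h : (ShortComplex.mk (K.iCycles i) (K.d i j) (K.iCycles_d i j)).Exact :=
    ShortComplex.exact_of_f_is_kernel _ (K.cyclesIsKernel i j hj)
  exact (ShortComplex.moduleCat_exact_iff _).1 h x hx

theorem iCycles_injective (i : ι) : Function.Injective (K.iCycles i) :=
  (ModuleCat.mono_iff_injective _).1 inferInstance

theorem homologyπ_surjective (i : ι) : Function.Surjective (K.homologyπ i) :=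
  (ModuleCat.epi_iff_surjective _).1 inferInstance

theorem homologyπ_eq_zero_iff {i j : ι} (hi : c.prev j = i) (z : K.cycles j) :
    K.homologyπ j z = 0 ↔ ∃ y : K.X i, K.d i j y = K.iCycles j z := by
  have h : (ShortComplex.mk (K.toCycles i j) (K.homologyπ j)
      (K.toCycles_comp_homologyπ i j)).Exact :=
    ShortComplex.exact_of_g_is_cokernel _ (K.homologyIsCokernel i j hi)
  have hi : ∀ y : K.X i, K.iCycles j (K.toCycles i j y) = K.d i j y := fun y => by
    rw [← ConcreteCategory.comp_apply, K.toCycles_i]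
  constructor
  · intro hz
    obtain ⟨y, rfl⟩ := (ShortComplex.moduleCat_exact_iff _).1 h z hz
    exact ⟨y, (hi y).symm⟩
  · rintro ⟨y, hy⟩
    rw [← iCycles_injective j ((hi y).trans hy), ← ConcreteCategory.comp_apply,
      K.toCycles_comp_homologyπ]
    rfl

theorem iCycles_cyclesMap_apply (f : K ⟶ L) {i : ι} (z : K.cycles i) :
    L.iCycles i (HomologicalComplex.cyclesMap f i z) = f.f i (K.iCycles i z) := by
  rw [← ConcreteCategory.comp_apply, HomologicalComplex.cyclesMap_i, ConcreteCategory.comp_apply]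

theorem homologyMap_homologyπ_apply (f : K ⟶ L) {i : ι} (z : K.cycles i) :
    HomologicalComplex.homologyMap f i (K.homologyπ i z) =
      L.homologyπ i (HomologicalComplex.cyclesMap f i z) := by
  rw [← ConcreteCategory.comp_apply, HomologicalComplex.homologyπ_naturality,
    ConcreteCategory.comp_apply]

end Elements

/-! ## Filling singular cycles -/

section Filling

open Simplicial

variable (R : Type v) [Ring R] (Y : TopCat.{u})

/-- The coefficient module. -/
noncomputable abbrev coefficients (R : Type v) [Ring R] : ModuleCat.{max u v} R :=
  ModuleCat.of R (ULift.{u} R)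

/-- The singular chain complex of `Y` with coefficients in `R`. -/
noncomputable abbrev singularComplex : ChainComplex (ModuleCat.{max u v} R) ℕ :=
  (TopCat.toSSet.obj Y).chainComplex (coefficients.{u} R)

variable {Y} in
/-- The map of singular chain complexes induced by a continuous map. -/
noncomputable abbrev singularComplexMap {Z : TopCat.{u}} (f : Y ⟶ Z) :
    singularComplex R Y ⟶ singularComplex R Z :=
  SSet.chainComplexMap (TopCat.toSSet.map f) (coefficients.{u} R)

variable {Y} in
theorem singularHomologyMap_eq {Z : TopCat.{u}} (f : Y ⟶ Z) (k : ℕ) :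
    singularHomologyMap R k f = HomologicalComplex.homologyMap (singularComplexMap R f) k := rfl

/-- The simplices of the singular simplicial set as continuous maps. -/
noncomputable def simplexEquiv (n : ℕ) :
    (TopCat.toSSet.obj Y) _⦋n⦌ ≃ C(stdSimplex ℝ (Fin (n + 1)), Y) :=
  TopCat.toSSetObjEquiv Y (.op ⦋n⦌)

/-- The inclusion of a generator. -/
noncomputable abbrev singularGenerator {n : ℕ} (s : (TopCat.toSSet.obj Y) _⦋n⦌) :
    (coefficients.{u} R) ⟶ (singularComplex R Y).X n :=
  (TopCat.toSSet.obj Y).ιChainComplex s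

/-- The comparison map from free modules on singular simplices to the singular chain complex. -/
noncomputable def toSingularComplex (n : ℕ) :
    SingularChain R Y n →ₗ[R] (singularComplex R Y).X n :=
  Finsupp.linearCombination R fun s =>
    singularGenerator R Y ((simplexEquiv Y n).symm s) (ULift.up (1 : R))

/-- The comparison map from the singular chain complex to free modules on singular simplices. -/
noncomputable def ofSingularComplex (n : ℕ) :
    (singularComplex R Y).X n ⟶ ModuleCat.of R (SingularChain R Y n) :=
  ((TopCat.toSSet.obj Y).isColimitChainComplexXCofan (coefficients.{u} R) n).desc (Limits.Cofan.mk _ fun s =>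
    ModuleCat.ofHom ((Finsupp.lsingle (simplexEquiv Y n s)) ∘ₗ
      (ULift.moduleEquiv (R := R) (M := R)).toLinearMap))

variable {R Y}

theorem singularGenerator_ofSingularComplex {n : ℕ} (s : (TopCat.toSSet.obj Y) _⦋n⦌) :
    singularGenerator R Y s ≫ ofSingularComplex R Y n =
      ModuleCat.ofHom ((Finsupp.lsingle (simplexEquiv Y n s)) ∘ₗ
        (ULift.moduleEquiv (R := R) (M := R)).toLinearMap) :=
  ((TopCat.toSSet.obj Y).isColimitChainComplexXCofan (coefficients.{u} R) n).fac _ ⟨s⟩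

theorem ofSingularComplex_generator {n : ℕ} (s : (TopCat.toSSet.obj Y) _⦋n⦌) (r : ULift.{u} R) :
    (ofSingularComplex R Y n) (singularGenerator R Y s r) =
      Finsupp.single (simplexEquiv Y n s) r.down :=
  ConcreteCategory.congr_hom (singularGenerator_ofSingularComplex s) r

theorem toSingularComplex_single {n : ℕ} (s : C(stdSimplex ℝ (Fin (n + 1)), Y)) :
    toSingularComplex R Y n (Finsupp.single s 1) =
      singularGenerator R Y ((simplexEquiv Y n).symm s) (ULift.up (1 : R)) := by
  rw [toSingularComplex, Finsupp.linearCombination_single, one_smul]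

/-- This one composite suffices: a filling found in the categorical chain complex is carried back to
the free module, where it has to bound the original chain. -/
theorem ofSingularComplex_toSingularComplex {n : ℕ} (c : SingularChain R Y n) :
    ofSingularComplex R Y n (toSingularComplex R Y n c) = c := by
  suffices h : (ofSingularComplex R Y n).hom ∘ₗ toSingularComplex R Y n = LinearMap.id from
    LinearMap.congr_fun h c
  refine linearMap_ext_single fun s => ?_
  rw [LinearMap.comp_apply, toSingularComplex_single]
  refine (ofSingularComplex_generator _ _).trans ?_
  rw [Equiv.apply_symm_apply]
  rfl

theorem d_singularGenerator {n : ℕ} (s : (TopCat.toSSet.obj Y) _⦋n + 1⦌) (r : ULift.{u} R) :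
    (singularComplex R Y).d (n + 1) n (singularGenerator R Y s r) =
      ∑ i : Fin (n + 2), (-1 : ℤ) ^ (i : ℕ) •
        singularGenerator R Y ((TopCat.toSSet.obj Y).δ i s) r := by
  have h := ConcreteCategory.congr_hom ((TopCat.toSSet.obj Y).ιChainComplex_d
    (coefficients.{u} R) s) r
  refine h.trans ?_
  simp

theorem d_toSingularComplex {n : ℕ} (c : SingularChain R Y (n + 1)) :
    (singularComplex R Y).d (n + 1) n (toSingularComplex R Y (n + 1) c) =
      toSingularComplex R Y n (singularBoundary R Y n c) := by
  suffices h : ((singularComplex R Y).d (n + 1) n).hom ∘ₗ toSingularComplex R Y (n + 1) =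
      toSingularComplex R Y n ∘ₗ singularBoundary R Y n from LinearMap.congr_fun h c
  refine linearMap_ext_single fun s => ?_
  rw [LinearMap.comp_apply, LinearMap.comp_apply, toSingularComplex_single, singularBoundary_single,
    map_sum]
  refine (d_singularGenerator _ _).trans (Finset.sum_congr rfl fun i _ => ?_)
  rw [map_zsmul, toSingularComplex_single]
  rfl

theorem singularBoundary_ofSingularComplex {n : ℕ} (x : (singularComplex R Y).X (n + 1)) :
    singularBoundary R Y n (ofSingularComplex R Y (n + 1) x) =
      ofSingularComplex R Y n ((singularComplex R Y).d (n + 1) n x) := by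
  suffices h : ofSingularComplex R Y (n + 1) ≫ ModuleCat.ofHom (singularBoundary R Y n) =
      (singularComplex R Y).d (n + 1) n ≫ ofSingularComplex R Y n from
    ConcreteCategory.congr_hom h x
  refine SSet.chainComplex_hom_ext fun s => ?_
  ext r : 2
  change singularBoundary R Y n (ofSingularComplex R Y (n + 1) (singularGenerator R Y s r)) =
    ofSingularComplex R Y n ((singularComplex R Y).d (n + 1) n (singularGenerator R Y s r))
  rw [ofSingularComplex_generator, d_singularGenerator, map_sum, singularBoundary_single]
  refine Finset.sum_congr rfl fun i _ => ?_
  rw [map_zsmul, ofSingularComplex_generator]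
  rfl

theorem map_toSingularComplex {Z : TopCat.{u}} (f : Y ⟶ Z) {n : ℕ} (c : SingularChain R Y n) :
    (singularComplexMap R f).f n
      (toSingularComplex R Y n c) = toSingularComplex R Z n (mapSingular R f.hom n c) := by
  suffices h : ((singularComplexMap R f).f n).hom ∘ₗ toSingularComplex R Y n =
      toSingularComplex R Z n ∘ₗ mapSingular R f.hom n from LinearMap.congr_fun h c
  refine linearMap_ext_single fun s => ?_
  rw [LinearMap.comp_apply, LinearMap.comp_apply, toSingularComplex_single, mapSingular_single,
    toSingularComplex_single]
  exact ConcreteCategory.congr_hom (SSet.ι_chainComplexMap_f _ _ (TopCat.toSSet.map f)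
    (coefficients.{u} R) ((simplexEquiv Y n).symm s)) (ULift.up 1)

/-- All `0`-simplices have the same image, so the chain map to the point only records the
augmentation. -/
theorem mapSingular_punit_eq_zero (f : C(Y, PUnit.{u + 1})) {c : SingularChain R Y 0}
    (hc : augmentation R _ c = 0) : mapSingular R f 0 c = 0 := by
  let p : C(stdSimplex ℝ (Fin 1), PUnit.{u + 1}) := ⟨fun _ => PUnit.unit, continuous_const⟩
  have h : mapSingular R f 0 = (augmentation R _).smulRight (Finsupp.single p 1) :=
    linearMap_ext_single fun s => by
      rw [mapSingular_single, LinearMap.smulRight_apply, augmentation_single, one_smul]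
  rw [h, LinearMap.smulRight_apply, hc, zero_smul]

/-- A reduced cycle becomes a boundary under an inclusion that is trivial on reduced homology. -/
theorem InclusionTrivial.exists_filling_subtype {Y : Type u} [TopologicalSpace Y] {A B : Set Y}
    {k : ℕ} {h : A ⊆ B} (ht : InclusionTrivial R k h) {w : SingularChain R A k}
    (hw : IsReducedCycle w) :
    ∃ z : SingularChain R B (k + 1), singularBoundary R B k z =
      mapSingular R ⟨Set.inclusion h, continuous_inclusion h⟩ k w := by
  -- For `k = 0` the truncated `k - 1` is `0`, and `d 0 0` vanishes because `0` and `0` are not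
  -- consecutive degrees.
  have hd : (singularComplex R (TopCat.of A)).d k (k - 1)
      (toSingularComplex R (TopCat.of A) k w) = 0 := by
    cases k with
    | zero => rw [(singularComplex R (TopCat.of A)).shape 0 _ (by simp)]; rfl
    | succ k =>
      refine (d_toSingularComplex (R := R) (Y := TopCat.of A) w).trans ?_
      exact (congrArg _ hw).trans (map_zero _)
  obtain ⟨z, hz⟩ := exists_cycle (K := singularComplex R (TopCat.of A))
    (by cases k <;> simp) _ hd
  -- In degree zero the image in the point vanishes already as a chain; in positive degrees the
  -- homology of the point is zero.
  have hred : (singularComplex R (TopCat.of A)).homologyπ k z ∈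
      reducedHomology R k (TopCat.of A) := by
    change singularHomologyMap R k _ ((singularComplex R (TopCat.of A)).homologyπ k z) = 0
    cases k with
    | zero =>
      rw [singularHomologyMap_eq]
      refine (homologyMap_homologyπ_apply _ z).trans ?_
      refine (congrArg _ (iCycles_injective 0 ?_)).trans (map_zero _)
      refine (iCycles_cyclesMap_apply _ _).trans ?_
      rw [hz, map_zero]
      refine (map_toSingularComplex _ _).trans ?_
      exact (congrArg _ (mapSingular_punit_eq_zero (Y := TopCat.of A) _ hw)).trans (map_zero _)
    | succ k =>
      have h0 := AlgebraicTopology.isZero_singularHomologyFunctor_of_totallyDisconnectedSpace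
        (ModuleCat.{max u v} R) (k + 1) (coefficients.{u} R)
        (TopCat.of PUnit.{u + 1}) (Nat.succ_ne_zero k)
      have := ModuleCat.subsingleton_of_isZero h0
      exact Subsingleton.elim _ _
  have hzero := ht _ hred
  change singularHomologyMap R k _ ((singularComplex R (TopCat.of A)).homologyπ k z) = 0 at hzero
  rw [singularHomologyMap_eq] at hzero
  obtain ⟨y, hy⟩ := (homologyπ_eq_zero_iff (i := k + 1) (by simp) _).1
    ((homologyMap_homologyπ_apply _ z).symm.trans hzero)
  have hy' := hy.trans (iCycles_cyclesMap_apply _ _)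
  rw [hz] at hy'
  refine ⟨ofSingularComplex R (TopCat.of B) (k + 1) y, ?_⟩
  refine (singularBoundary_ofSingularComplex y).trans ?_
  rw [hy']
  refine (congrArg _ (map_toSingularComplex (Y := TopCat.of A) (Z := TopCat.of B)
    (TopCat.ofHom ⟨Set.inclusion h, continuous_inclusion h⟩) w)).trans ?_
  exact ofSingularComplex_toSingularComplex _

theorem exists_restrict_singularChain {Y : Type*} [TopologicalSpace Y] {A C : Set Y} (hC : C ⊆ A)
    {k : ℕ} {w : SingularChain R Y k} (hw : w ∈ singularChainsIn R C k) :
    ∃ w' ∈ singularChainsIn R ((Subtype.val : A → Y) ⁻¹' C) k,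
      mapSingular R ⟨Subtype.val, continuous_subtype_val⟩ k w' = w := by
  suffices h : w ∈ (singularChainsIn R ((Subtype.val : A → Y) ⁻¹' C) k).map
      (mapSingular R (⟨Subtype.val, continuous_subtype_val⟩ : C(A, Y)) k) from h
  refine map_mem_of_mem_supported LinearMap.id _ (fun s hs => ?_) hw
  refine ⟨Finsupp.single ⟨fun t => ⟨s t, hC (hs ⟨t, rfl⟩)⟩, by fun_prop⟩ 1,
    single_one_mem_supported ?_, ?_⟩
  · rintro _ ⟨t, rfl⟩
    exact hs ⟨t, rfl⟩
  · rw [mapSingular_single]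
    rfl

theorem mapSingular_subtype_injective {Y : Type*} [TopologicalSpace Y] (A : Set Y) (k : ℕ) :
    Function.Injective (mapSingular R (⟨Subtype.val, continuous_subtype_val⟩ : C(A, Y)) k) := by
  refine Finsupp.mapDomain_injective fun s t h => ?_
  ext x
  exact DFunLike.congr_fun h x

theorem isReducedCycle_of_mapSingular_subtype {Y : Type*} [TopologicalSpace Y] {A : Set Y} {k : ℕ}
    {w : SingularChain R A k}
    (hw : IsReducedCycle (mapSingular R ⟨Subtype.val, continuous_subtype_val⟩ k w)) :
    IsReducedCycle w := by
  cases k with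
  | zero => exact (augmentation_mapSingular _ w).symm.trans hw
  | succ k =>
    refine mapSingular_subtype_injective A k ?_
    rw [map_zero, ← singularBoundary_mapSingular]
    exact hw

theorem mapSingular_mapSingular {X Y Z : Type*} [TopologicalSpace X] [TopologicalSpace Y]
    [TopologicalSpace Z] (g : C(Y, Z)) (f : C(X, Y)) {k : ℕ} (c : SingularChain R X k) :
    mapSingular R g k (mapSingular R f k c) = mapSingular R (g.comp f) k c := by
  simp only [mapSingular, Finsupp.lmapDomain_apply, ← Finsupp.mapDomain_comp]
  rfl

theorem mapSingular_mem {Y Z : Type*} [TopologicalSpace Y] [TopologicalSpace Z] {f : C(Y, Z)}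
    {A : Set Y} {C : Set Z} (h : Set.MapsTo f A C) {k : ℕ} {c : SingularChain R Y k}
    (hc : c ∈ singularChainsIn R A k) : mapSingular R f k c ∈ singularChainsIn R C k := by
  refine mapDomain_mem_supported _ (fun s hs => ?_) hc
  rintro _ ⟨t, rfl⟩
  exact h (hs ⟨t, rfl⟩)

/-- A chain carried by `A` comes from the subspace `A`, and pushing forward along the inclusion is
injective on chains, so being a reduced cycle descends. This allows all later fillings to be made
inside one ambient space. -/
theorem InclusionTrivial.exists_filling {Y : Type u} [TopologicalSpace Y] {A B : Set Y}
    {k : ℕ} {h : A ⊆ B} (ht : InclusionTrivial R k h) {w : SingularChain R Y k}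
    (hA : w ∈ singularChainsIn R A k) (hw : IsReducedCycle w) :
    ∃ z ∈ singularChainsIn R B (k + 1), singularBoundary R Y k z = w := by
  obtain ⟨w, -, rfl⟩ := exists_restrict_singularChain subset_rfl hA
  obtain ⟨z, hz⟩ := ht.exists_filling_subtype (isReducedCycle_of_mapSingular_subtype hw)
  refine ⟨mapSingular R ⟨Subtype.val, continuous_subtype_val⟩ (k + 1) z,
    mapSingular_mem (A := Set.univ) (fun x _ => x.2) fun _ _ => Set.subset_univ _, ?_⟩
  rw [singularBoundary_mapSingular, hz, mapSingular_mapSingular]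
  rfl

end Filling

/-! ## Filling tuples by singular chains -/

section TupleLift

variable {R : Type v} [Ring R] {X : Type*}

/-- The linear extension of a map defined on tuples. -/
noncomputable abbrev tupleLift {n : ℕ} {N : Type*} [AddCommGroup N] [Module R N]
    (f : (Fin (n + 1) → X) → N) : TupleChain R X n →ₗ[R] N :=
  Finsupp.linearCombination R f

theorem tupleLift_single {n : ℕ} {N : Type*} [AddCommGroup N] [Module R N]
    (f : (Fin (n + 1) → X) → N) (σ : Fin (n + 1) → X) :
    tupleLift f (Finsupp.single σ (1 : R)) = f σ := by
  rw [Finsupp.linearCombination_single, one_smul]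

theorem map_tupleBoundary_single_mem {n : ℕ} {N : Type*} [AddCommGroup N] [Module R N]
    (f : TupleChain R X n →ₗ[R] N) (σ : Fin (n + 2) → X) (P : Submodule R N)
    (h : ∀ i : Fin (n + 2), f (Finsupp.single (σ ∘ i.succAbove) 1) ∈ P) :
    f (tupleBoundary R X n (Finsupp.single σ 1)) ∈ P := by
  rw [tupleBoundary_single, map_sum]
  refine Submodule.sum_mem _ fun i _ => ?_
  rw [map_zsmul]
  exact zsmul_mem (h i) _

theorem tupleBoundary_single_mem_supported {n : ℕ} {G : (Fin (n + 1) → X) → Prop}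
    {σ : Fin (n + 2) → X} (h : ∀ i : Fin (n + 2), G (σ ∘ i.succAbove)) :
    tupleBoundary R X n (Finsupp.single σ 1) ∈ Finsupp.supported R R {τ | G τ} := by
  rw [tupleBoundary_single]
  exact Submodule.sum_mem _ fun i _ =>
    zsmul_mem (single_one_mem_supported (s := {τ | G τ}) (h i)) _

theorem eq_const_of_fin_one (σ : Fin (0 + 1) → X) : σ = fun _ => σ 0 :=
  funext fun i => by rw [Fin.fin_one_eq_zero i]

theorem tupleChainsIn_mono {A B : Set X} (h : A ⊆ B) (n : ℕ) :
    tupleChainsIn R A n ≤ tupleChainsIn R B n := by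
  have hsub : {s : Fin (n + 1) → X | Set.range s ⊆ A} ⊆ {s | Set.range s ⊆ B} :=
    fun s hs => hs.trans h
  exact Finsupp.supported_mono hsub

end TupleLift

/-! ### Almost optimal singular fillings of tuples in a metric space -/

section Fillings

variable {R : Type v} [Ring R] {X : Type u} [MetricSpace X]

/-- The closed `t`-neighbourhood of the set of entries of a tuple. -/
def tupleNhd {n : ℕ} (σ : Fin (n + 1) → X) (t : ℝ) : Set X := {x | ∃ i, dist x (σ i) ≤ t}

theorem tupleNhd_mono {n : ℕ} (σ : Fin (n + 1) → X) {s t : ℝ} (h : s ≤ t) :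
    tupleNhd σ s ⊆ tupleNhd σ t := fun _ ⟨i, hi⟩ => ⟨i, hi.trans h⟩

theorem tupleNhd_face {n : ℕ} (σ : Fin (n + 2) → X) (i : Fin (n + 2)) (t : ℝ) :
    tupleNhd (σ ∘ i.succAbove) t ⊆ tupleNhd σ t := fun _ ⟨j, hj⟩ => ⟨i.succAbove j, hj⟩

theorem range_subset_tupleNhd {n : ℕ} (σ : Fin (n + 1) → X) {t : ℝ} (ht : 0 ≤ t) :
    Set.range σ ⊆ tupleNhd σ t := by
  rintro _ ⟨i, rfl⟩
  exact ⟨i, by simpa using ht⟩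

theorem dist_le_of_mem_tupleNhd {n : ℕ} {σ : Fin (n + 1) → X} {r s t : ℝ}
    (hσ : ∀ i j, dist (σ i) (σ j) ≤ r) {x y : X} (hx : x ∈ tupleNhd σ s)
    (hy : y ∈ tupleNhd σ t) : dist x y ≤ s + r + t := by
  obtain ⟨i, hi⟩ := hx
  obtain ⟨j, hj⟩ := hy
  have h1 := dist_triangle4 x (σ i) (σ j) y
  have h2 := hσ i j
  rw [dist_comm (σ j) y] at h1
  linarith

/-- The constant singular simplex. -/
def constSimplex (n : ℕ) (x : X) : C(stdSimplex ℝ (Fin (n + 1)), X) := ContinuousMap.const _ x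

theorem singularFace_constSimplex {n : ℕ} (i : Fin (n + 2)) (x : X) :
    singularFace i (constSimplex (n + 1) x) = constSimplex n x := rfl

theorem single_constSimplex_mem {n : ℕ} {x : X} {A : Set X} (h : x ∈ A) :
    Finsupp.single (constSimplex n x) (1 : R) ∈ singularChainsIn R A n := by
  refine single_one_mem_supported ?_
  rintro _ ⟨t, rfl⟩
  exact h

/-- Fillings of prescribed boundaries whose sizes are almost optimal. -/
theorem exists_almost_optimal_filling {n : ℕ} (f : (Fin (n + 1) → X) → SingularChain R X n) :
    ∃ g : (Fin (n + 2) → X) → SingularChain R X (n + 1),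
      (∀ x, g (fun _ => x) = Finsupp.single (constSimplex (n + 1) x) 1) ∧
      ∀ σ : Fin (n + 2) → X, (σ ≠ fun _ => σ 0) → ∀ t, 0 ≤ t →
        (∃ z ∈ singularChainsIn R (tupleNhd σ t) (n + 1),
          singularBoundary R X n z = tupleLift f (tupleBoundary R X n (Finsupp.single σ 1))) →
        singularBoundary R X n (g σ) = tupleLift f (tupleBoundary R X n (Finsupp.single σ 1)) ∧
          g σ ∈ singularChainsIn R (tupleNhd σ (t + dist σ fun _ => σ 0)) (n + 1) := by
  suffices h : ∀ σ : Fin (n + 2) → X, ∃ c : SingularChain R X (n + 1),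
      ((σ = fun _ => σ 0) → c = Finsupp.single (constSimplex (n + 1) (σ 0)) 1) ∧
      ((σ ≠ fun _ => σ 0) → ∀ t, 0 ≤ t →
        (∃ z ∈ singularChainsIn R (tupleNhd σ t) (n + 1),
          singularBoundary R X n z = tupleLift f (tupleBoundary R X n (Finsupp.single σ 1))) →
        singularBoundary R X n c = tupleLift f (tupleBoundary R X n (Finsupp.single σ 1)) ∧
          c ∈ singularChainsIn R (tupleNhd σ (t + dist σ fun _ => σ 0)) (n + 1)) by
    choose g h1 h2 using h
    exact ⟨g, fun x => h1 _ rfl, h2⟩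
  intro σ
  by_cases hσ : σ = fun _ => σ 0
  · exact ⟨_, fun _ => rfl, fun h => absurd hσ h⟩
  set T : Set ℝ := {t | 0 ≤ t ∧ ∃ z ∈ singularChainsIn R (tupleNhd σ t) (n + 1),
    singularBoundary R X n z = tupleLift f (tupleBoundary R X n (Finsupp.single σ 1))}
  by_cases hT : T.Nonempty
  -- The infimum of the admissible radii need not be attained, but the slack is positive since `σ`
  -- is not constant. The resulting `z` serves all admissible radii `t` simultaneously.
  · obtain ⟨t₀, ⟨-, z, hz, hzw⟩, ht₀⟩ := Real.lt_sInf_add_pos hT (dist_pos.2 hσ)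
    refine ⟨z, fun h => absurd h hσ, fun _ t ht hf => ⟨hzw, ?_⟩⟩
    have hle : sInf T ≤ t := csInf_le ⟨0, fun s hs => hs.1⟩ ⟨ht, hf⟩
    have hsub : {s : C(stdSimplex ℝ (Fin (n + 2)), X) | Set.range s ⊆ tupleNhd σ t₀} ⊆
        {s | Set.range s ⊆ tupleNhd σ (t + dist σ fun _ => σ 0)} := fun s hs =>
      hs.trans (tupleNhd_mono σ (by linarith))
    exact Finsupp.supported_mono hsub hz
  -- The value `0` is a default for tuples that have no filling at any radius.
  · exact ⟨0, fun h => absurd h hσ, fun _ t ht hf => absurd ⟨t, ht, hf⟩ hT⟩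

/-- A system of singular fillings of tuples, of almost optimal size at each stage. -/
theorem exists_filling_system (R : Type v) [Ring R] (X : Type u) [MetricSpace X] :
    ∃ S : ∀ n, (Fin (n + 1) → X) → SingularChain R X n,
      (∀ n x, S n (fun _ => x) = Finsupp.single (constSimplex n x) 1) ∧
      ∀ n (σ : Fin (n + 2) → X), (σ ≠ fun _ => σ 0) → ∀ t, 0 ≤ t →
        (∃ z ∈ singularChainsIn R (tupleNhd σ t) (n + 1),
          singularBoundary R X n z = tupleLift (S n) (tupleBoundary R X n (Finsupp.single σ 1))) →
        singularBoundary R X n (S (n + 1) σ) =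
            tupleLift (S n) (tupleBoundary R X n (Finsupp.single σ 1)) ∧
          S (n + 1) σ ∈ singularChainsIn R (tupleNhd σ (t + dist σ fun _ => σ 0)) (n + 1) := by
  choose g hg1 hg2 using
    fun n => exists_almost_optimal_filling (R := R) (X := X) (n := n)
  refine ⟨fun n => Nat.rec (fun σ => Finsupp.single (constSimplex 0 (σ 0)) 1)
    (fun n f => g n f) n, fun n x => ?_, fun n σ => hg2 n _ σ⟩
  cases n with
  | zero => rfl
  | succ n => exact hg1 n _ x

/-- The tuples all of whose iterated faces are filled compatibly with the boundary. -/
def IsFilled (S : ∀ n, (Fin (n + 1) → X) → SingularChain R X n) :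
    ∀ n, (Fin (n + 1) → X) → Prop
  | 0, _ => True
  | n + 1, σ => (∀ i : Fin (n + 2), IsFilled S n (σ ∘ i.succAbove)) ∧
      singularBoundary R X n (S (n + 1) σ) =
        tupleLift (S n) (tupleBoundary R X n (Finsupp.single σ 1))

variable {S : ∀ n, (Fin (n + 1) → X) → SingularChain R X n}

/-- The faces of a constant simplex are constant simplices, so both boundaries are the same
alternating sum. Constant tuples need this separate treatment because their slack is zero. -/
theorem isFilled_const (hS : ∀ n x, S n (fun _ => x) = Finsupp.single (constSimplex n x) 1)
    (n : ℕ) (x : X) : IsFilled S n fun _ => x := by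
  induction n with
  | zero => trivial
  | succ n ih =>
    refine ⟨fun _ => ih, ?_⟩
    rw [hS, singularBoundary_single, tupleBoundary_single, map_sum]
    refine Finset.sum_congr rfl fun i _ => ?_
    rw [map_zsmul, tupleLift_single, singularFace_constSimplex, ← hS]
    rfl

theorem singularBoundary_tupleLift {n : ℕ} {c : TupleChain R X (n + 1)}
    (hc : c ∈ Finsupp.supported R R {τ | IsFilled S (n + 1) τ}) :
    singularBoundary R X n (tupleLift (S (n + 1)) c) =
      tupleLift (S n) (tupleBoundary R X n c) :=
  eqOn_supported (f := singularBoundary R X n ∘ₗ tupleLift (S (n + 1)))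
    (g := tupleLift (S n) ∘ₗ tupleBoundary R X n)
    (fun σ hσ => by
      rw [LinearMap.comp_apply, LinearMap.comp_apply, tupleLift_single]
      exact hσ.2) hc

/-- On filled tuples `S` commutes with boundaries, so this is `∂∂ = 0`; in degree zero `S` preserves
the augmentation, which vanishes on boundaries. -/
theorem isReducedCycle_of_faces (hS : ∀ n x, S n (fun _ => x) = Finsupp.single (constSimplex n x) 1)
    {n : ℕ} {σ : Fin (n + 2) → X} (h : ∀ i : Fin (n + 2), IsFilled S n (σ ∘ i.succAbove)) :
    IsReducedCycle (tupleLift (S n) (tupleBoundary R X n (Finsupp.single σ 1))) := by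
  cases n with
  | zero =>
    have haug : augmentation R _ ∘ₗ tupleLift (S 0) = augmentation R (Fin 1 → X) :=
      linearMap_ext_single fun τ => by
        rw [LinearMap.comp_apply, tupleLift_single, augmentation_single,
          eq_const_of_fin_one τ, hS,
          augmentation_single]
    exact (LinearMap.congr_fun haug _).trans (augmentation_tupleBoundary _)
  | succ n =>
    refine (singularBoundary_tupleLift (tupleBoundary_single_mem_supported h)).trans ?_
    rw [tupleBoundary_tupleBoundary, map_zero]

theorem dist_const_le {n : ℕ} {σ : Fin (n + 1) → X} {r : ℝ} (hσ : ∀ i j, dist (σ i) (σ j) ≤ r) :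
    dist σ (fun _ => σ 0) ≤ r :=
  (dist_pi_le_iff (dist_nonneg.trans (hσ 0 0))).2 fun i => hσ i 0

theorem singularChainsIn_mono {A B : Set X} (h : A ⊆ B) (n : ℕ) :
    singularChainsIn R A n ≤ singularChainsIn R B n := by
  have hsub : {s : C(stdSimplex ℝ (Fin (n + 1)), X) | Set.range s ⊆ A} ⊆
      {s | Set.range s ⊆ B} := fun s hs => hs.trans h
  exact Finsupp.supported_mono hsub

/-! ### Size of the fillings far from the base point and near a point -/

section Far

variable (hS : ∀ n x, S n (fun _ => x) = Finsupp.single (constSimplex n x) 1)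
  (hopt : ∀ n (σ : Fin (n + 2) → X), (σ ≠ fun _ => σ 0) → ∀ t, 0 ≤ t →
    (∃ z ∈ singularChainsIn R (tupleNhd σ t) (n + 1),
      singularBoundary R X n z = tupleLift (S n) (tupleBoundary R X n (Finsupp.single σ 1))) →
    singularBoundary R X n (S (n + 1) σ) =
        tupleLift (S n) (tupleBoundary R X n (Finsupp.single σ 1)) ∧
      S (n + 1) σ ∈ singularChainsIn R (tupleNhd σ (t + dist σ fun _ => σ 0)) (n + 1))

include hS hopt

/-- By induction the filled faces lie in a neighbourhood of `σ` of controlled radius. Uniform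
acyclicity bounds the resulting cycle nearby, and almost optimality transfers this bound to the
filling chosen in advance. -/
theorem isFilled_of_far {μ ρ : NNReal → NNReal} {b : X} (hμ : Monotone μ) (hρ : Monotone ρ)
    (hU : ∀ (r : NNReal) (B : Set X), B.Nonempty → Bornology.IsBounded B → Metric.diam B = r →
      (μ r : ℝ) ≤ Metric.infDist b B →
        ∀ k : ℕ, InclusionTrivial R k (Metric.self_subset_cthickening (δ := (ρ r : ℝ)) B))
    (n : ℕ) {r : ℝ} (hr : 0 ≤ r) :
    ∃ s D : ℝ, 0 ≤ s ∧ ∀ σ : Fin (n + 1) → X, (∀ i j, dist (σ i) (σ j) ≤ r) →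
      (∀ i, D ≤ dist (σ i) b) → IsFilled S n σ ∧ S n σ ∈ singularChainsIn R (tupleNhd σ s) n := by
  induction n with
  | zero =>
    refine ⟨0, 0, le_rfl, fun σ _ _ => ⟨trivial, ?_⟩⟩
    rw [eq_const_of_fin_one σ, hS]
    exact single_constSimplex_mem ⟨0, by simp⟩
  | succ n ih =>
    obtain ⟨s, D, hs, h⟩ := ih
    -- `q` bounds the diameter of the `s`-neighbourhood of `σ`; monotonicity of `μ` and `ρ` then
    -- makes the constants independent of `σ`.
    let q : NNReal := ⟨s + r + s, by positivity⟩
    have hρ0 : (0 : ℝ) ≤ ρ q := (ρ q).2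
    -- The `1` replaces a closed neighbourhood by an open one, `r` bounds the slack, and `s + μ q`
    -- keeps the whole `s`-neighbourhood at distance at least `μ q` from `b`.
    refine ⟨s + (ρ q + 1) + r, max D (s + μ q), by positivity, fun σ hσ hD => ?_⟩
    by_cases hc : σ = fun _ => σ 0
    · rw [hc]
      refine ⟨isFilled_const hS _ _, ?_⟩
      rw [hS]
      exact single_constSimplex_mem ⟨0, by rw [dist_self]; positivity⟩
    have hface : ∀ i : Fin (n + 2), IsFilled S n (σ ∘ i.succAbove) ∧
        S n (σ ∘ i.succAbove) ∈ singularChainsIn R (tupleNhd (σ ∘ i.succAbove) s) n := fun i =>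
      h _ (fun _ _ => hσ _ _) fun _ => (le_max_left _ _).trans (hD _)
    set B := tupleNhd σ s with hB
    have hne : B.Nonempty := ⟨σ 0, range_subset_tupleNhd σ hs ⟨0, rfl⟩⟩
    have hdist : ∀ x ∈ B, ∀ y ∈ B, dist x y ≤ s + r + s := fun x hx y hy =>
      dist_le_of_mem_tupleNhd hσ hx hy
    have hbdd : Bornology.IsBounded B := Metric.isBounded_iff.2 ⟨_, fun x hx y hy => hdist x hx y hy⟩
    let d : NNReal := ⟨Metric.diam B, Metric.diam_nonneg⟩
    have hdq : d ≤ q := Metric.diam_le_of_forall_dist_le (by positivity) hdist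
    have hinf : (μ d : ℝ) ≤ Metric.infDist b B := by
      refine (Metric.le_infDist hne).2 ?_
      rintro y ⟨i, hi⟩
      have h1 : (μ d : ℝ) ≤ μ q := hμ hdq
      have h2 := (le_max_right _ _).trans (hD i)
      have h3 := dist_triangle (σ i) y b
      rw [dist_comm y b, dist_comm (σ i) y] at h3
      linarith
    have hw : tupleLift (S n) (tupleBoundary R X n (Finsupp.single σ 1)) ∈
        singularChainsIn R B n :=
      map_tupleBoundary_single_mem _ _ _ fun i => by
        rw [tupleLift_single]
        exact singularChainsIn_mono (tupleNhd_face σ i s) n (hface i).2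
    obtain ⟨z, hz, hzw⟩ := (hU d B hne hbdd rfl hinf n).exists_filling hw
      (isReducedCycle_of_faces hS fun i => (hface i).1)
    have hsub : Metric.cthickening (ρ d : ℝ) B ⊆ tupleNhd σ (s + (ρ q + 1)) := by
      have h1 : (ρ d : ℝ) ≤ ρ q := hρ hdq
      refine (Metric.cthickening_subset_thickening' (by positivity)
        (by linarith : (ρ d : ℝ) < ρ q + 1) B).trans fun x hx => ?_
      obtain ⟨y, ⟨i, hi⟩, hy⟩ := Metric.mem_thickening_iff.1 hx
      exact ⟨i, by linarith [dist_triangle x y (σ i)]⟩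
    obtain ⟨h1, h2⟩ := hopt n σ hc (s + (ρ q + 1)) (by positivity)
      ⟨z, singularChainsIn_mono hsub _ hz, hzw⟩
    exact ⟨⟨fun i => (hface i).1, h1⟩,
      singularChainsIn_mono (tupleNhd_mono σ (by linarith [dist_const_le hσ])) _ h2⟩

theorem isFilled_of_near {x : X}
    (hx : ∀ ε > 0, ∀ k, ∃ δ > 0, ∀ w ∈ singularChainsIn R (Metric.ball x δ) k, IsReducedCycle w →
      ∃ z ∈ singularChainsIn R (Metric.ball x ε) (k + 1), singularBoundary R X k z = w)
    (n : ℕ) {ε : ℝ} (hε : 0 < ε) :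
    ∃ δ > 0, ∀ σ : Fin (n + 1) → X, (∀ i, dist (σ i) x < δ) →
      IsFilled S n σ ∧ S n σ ∈ singularChainsIn R (Metric.ball x ε) n := by
  induction n generalizing ε with
  | zero =>
    refine ⟨ε, hε, fun σ hσ => ⟨trivial, ?_⟩⟩
    rw [eq_const_of_fin_one σ, hS]
    exact single_constSimplex_mem (hσ 0)
  | succ n ih =>
    obtain ⟨ε', hε', hfill⟩ := hx (ε / 4) (by positivity) n
    obtain ⟨δ, hδ, h⟩ := ih hε'
    -- A filling within `ε/4` of `x` is within `ε/4 + ε/8` of `σ`. The slack is at most `ε/4` and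
    -- the return from `σ` to `x` costs less than `ε/8`, in total less than `ε`.
    refine ⟨min δ (ε / 8), by positivity, fun σ hσ => ?_⟩
    have hσ8 : ∀ i, dist (σ i) x < ε / 8 := fun i => (hσ i).trans_le (min_le_right _ _)
    by_cases hc : σ = fun _ => σ 0
    · have h0 : dist (σ 0) x < ε := (hσ8 0).trans (by linarith)
      rw [hc]
      refine ⟨isFilled_const hS _ _, ?_⟩
      rw [hS]
      exact single_constSimplex_mem h0
    have hface : ∀ i : Fin (n + 2), IsFilled S n (σ ∘ i.succAbove) ∧
        S n (σ ∘ i.succAbove) ∈ singularChainsIn R (Metric.ball x ε') n := fun i =>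
      h _ fun _ => (hσ _).trans_le (min_le_left _ _)
    obtain ⟨z, hz, hzw⟩ := hfill _ (map_tupleBoundary_single_mem (tupleLift (S n)) σ _ fun i => by
      rw [tupleLift_single]
      exact (hface i).2) (isReducedCycle_of_faces hS fun i => (hface i).1)
    have hsub : Metric.ball x (ε / 4) ⊆ tupleNhd σ (ε / 4 + ε / 8) := fun y hy =>
      ⟨0, by linarith [dist_triangle_right y (σ 0) x, hσ8 0, Metric.mem_ball.1 hy]⟩
    obtain ⟨h1, h2⟩ := hopt n σ hc (ε / 4 + ε / 8) (by positivity)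
      ⟨z, singularChainsIn_mono hsub _ hz, hzw⟩
    refine ⟨⟨fun i => (hface i).1, h1⟩, singularChainsIn_mono ?_ _ h2⟩
    rintro y ⟨i, hi⟩
    have h3 := dist_const_le (σ := σ) (r := ε / 8 + ε / 8) fun j k => by
      linarith [dist_triangle_right (σ j) (σ k) x, hσ8 j, hσ8 k]
    rw [Metric.mem_ball]
    linarith [dist_triangle y (σ i) x, hσ8 i]

end Far

/-- At an interior point of `Kᶜ` small balls of `X` lie in `Kᶜ`, so local acyclicity of the subspace
can be read off in `X`. -/
theorem LocallyAcyclic.exists_filling {K : Set X} (hK : LocallyAcyclic R (Kᶜ : Set X)) {x : X}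
    (hx : Kᶜ ∈ nhds x) {ε : ℝ} (hε : 0 < ε) (k : ℕ) :
    ∃ δ > 0, ∀ w ∈ singularChainsIn R (Metric.ball x δ) k, IsReducedCycle w →
      ∃ z ∈ singularChainsIn R (Metric.ball x ε) (k + 1), singularBoundary R X k z = w := by
  obtain ⟨V, hV, hVU, ht⟩ := hK ⟨x, mem_of_mem_nhds hx⟩ (Subtype.val ⁻¹' Metric.ball x ε)
    (continuous_subtype_val.continuousAt.preimage_mem_nhds (Metric.ball_mem_nhds x hε)) k
  obtain ⟨W, hW, hWV⟩ := mem_nhds_subtype _ _ _ |>.1 hV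
  obtain ⟨δ, hδ, hball⟩ := Metric.mem_nhds_iff.1 (Filter.inter_mem hx hW)
  refine ⟨δ, hδ, fun w hw hcyc => ?_⟩
  have hKc : Metric.ball x δ ⊆ Kᶜ := fun y hy => (hball hy).1
  obtain ⟨w, hwV, rfl⟩ := exists_restrict_singularChain hKc hw
  obtain ⟨z, hz, hzw⟩ := ht.exists_filling (singularChainsIn_mono
    (fun y hy => hWV (hball hy).2) k hwV) (isReducedCycle_of_mapSingular_subtype hcyc)
  refine ⟨mapSingular R ⟨Subtype.val, continuous_subtype_val⟩ (k + 1) z,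
    mapSingular_mem (fun y hy => hy) hz, ?_⟩
  rw [singularBoundary_mapSingular, hzw]

/-- Under the acyclicity hypotheses, tuples can be filled by singular chains, with control at
large scales far away from a base point, and at small scales. -/
theorem exists_controlled_fillings (hU : UniformlyAcyclicAtInfinity R X)
    (hL : LocallyAcyclicAtInfinity R X) :
    ∃ (b : X) (S : ∀ n, (Fin (n + 1) → X) → SingularChain R X n),
      (∀ σ, S 0 σ = Finsupp.single (constSimplex 0 (σ 0)) 1) ∧
      (∀ n (r : ℝ), 0 ≤ r → ∃ s D : ℝ, 0 ≤ s ∧ ∀ σ : Fin (n + 1) → X,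
        (∀ i j, dist (σ i) (σ j) ≤ r) → (∀ i, D ≤ dist (σ i) b) →
          IsFilled S n σ ∧ S n σ ∈ singularChainsIn R (tupleNhd σ s) n) ∧
      ∃ D : ℝ, ∀ n x, D ≤ dist x b → ∀ ε > 0, ∃ δ > 0, ∀ σ : Fin (n + 1) → X,
        (∀ i, dist (σ i) x < δ) → IsFilled S n σ ∧ S n σ ∈ singularChainsIn R (Metric.ball x ε) n := by
  obtain ⟨μ, ρ, b, hμ, hρ, hU⟩ := hU
  obtain ⟨K, hK, hL⟩ := hL
  obtain ⟨S, hS, hopt⟩ := exists_filling_system R X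
  refine ⟨b, S, fun σ => ?_, fun n r hr => isFilled_of_far hS hopt hμ hρ hU n hr, ?_⟩
  · rw [eq_const_of_fin_one σ, hS]
  · obtain ⟨M, hM⟩ := hK.subset_closedBall b
    -- Beyond `M + 1` the point lies in the open complement of a closed ball containing `K`, hence
    -- in the interior of `Kᶜ`.
    refine ⟨M + 1, fun n x hx ε hε => isFilled_of_near hS hopt (fun ε hε k => ?_) n hε⟩
    refine hL.exists_filling ?_ hε k
    refine Filter.mem_of_superset (Metric.isClosed_closedBall.isOpen_compl.mem_nhds ?_)
      (Set.compl_subset_compl.2 hM)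
    rw [Set.mem_compl_iff, Metric.mem_closedBall]
    linarith

end Fillings

/-! ## Chain maps into small tuples and the comparison of cochains -/

section Comparison

variable {R : Type v} [Ring R] {X : Type u}

/-- The chain homotopy between the identity and `F`, obtained by coning off. -/
noncomputable def coneHomotopy (F : ∀ n, (Fin (n + 1) → X) → TupleChain R X n) :
    ∀ n, TupleChain R X n →ₗ[R] TupleChain R X (n + 1)
  | 0 => 0
  | n + 1 => tupleLift fun σ => cone R (n + 1) (σ 0) (Finsupp.single σ 1 - F (n + 1) σ -
      coneHomotopy F n (tupleBoundary R X n (Finsupp.single σ 1)))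

variable {F : ∀ n, (Fin (n + 1) → X) → TupleChain R X n}

theorem coneHomotopy_succ_single {n : ℕ} (σ : Fin (n + 2) → X) :
    coneHomotopy F (n + 1) (Finsupp.single σ 1) =
      cone R (n + 1) (σ 0) (Finsupp.single σ 1 - F (n + 1) σ -
        coneHomotopy F n (tupleBoundary R X n (Finsupp.single σ 1))) := by
  rw [coneHomotopy, tupleLift_single]

/-- The chain being coned off is a cycle: by the identity one degree lower, `∂H∂σ = ∂σ - F∂σ`. The
induction only meets faces of `σ`, so it suffices that `F` is a chain map on a class `G` of tuples
closed under faces. -/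
theorem tupleBoundary_coneHomotopy {G : ∀ n, (Fin (n + 1) → X) → Prop}
    (hG : ∀ n σ, G (n + 1) σ → ∀ i : Fin (n + 2), G n (σ ∘ i.succAbove))
    (h0 : ∀ σ, F 0 σ = Finsupp.single σ 1)
    (hF : ∀ n σ, G (n + 1) σ → tupleBoundary R X n (F (n + 1) σ) =
      tupleLift (F n) (tupleBoundary R X n (Finsupp.single σ 1)))
    {n : ℕ} {σ : Fin (n + 2) → X} (hσ : G (n + 1) σ) :
    tupleBoundary R X (n + 1) (coneHomotopy F (n + 1) (Finsupp.single σ 1)) +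
      coneHomotopy F n (tupleBoundary R X n (Finsupp.single σ 1)) =
        Finsupp.single σ 1 - F (n + 1) σ := by
  suffices h : tupleBoundary R X n (Finsupp.single σ 1 - F (n + 1) σ -
      coneHomotopy F n (tupleBoundary R X n (Finsupp.single σ 1))) = 0 by
    rw [coneHomotopy_succ_single, tupleBoundary_cone, h]
    simp
  rw [map_sub, map_sub, hF n σ hσ]
  induction n with
  | zero =>
    have hid : tupleLift (F 0) = LinearMap.id := linearMap_ext_single fun σ => by
      rw [tupleLift_single, h0]
      rfl
    rw [hid]
    simp [coneHomotopy]
  | succ n ih =>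
    have h := eqOn_supported (f := tupleBoundary R X (n + 1) ∘ₗ coneHomotopy F (n + 1) +
        coneHomotopy F n ∘ₗ tupleBoundary R X n) (g := LinearMap.id - tupleLift (F (n + 1)))
      (s := {τ | G (n + 1) τ}) (fun τ hτ => by
        have h := ih hτ
        rw [← hF n τ hτ, ← map_sub, ← map_sub] at h
        simp only [LinearMap.add_apply, LinearMap.comp_apply, LinearMap.sub_apply,
          LinearMap.id_apply, tupleLift_single]
        rw [coneHomotopy_succ_single, tupleBoundary_cone, h]
        simp) (tupleBoundary_single_mem_supported (R := R) (hG _ _ hσ))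
    simp only [LinearMap.add_apply, LinearMap.comp_apply, LinearMap.sub_apply,
      LinearMap.id_apply, tupleBoundary_tupleBoundary, map_zero, add_zero] at h
    rw [h, sub_self]

end Comparison

/-! ### Controlled homotopies and the correction of boundedly supported cochains -/

section Metric

variable {R : Type v} [Ring R] {X : Type u} [MetricSpace X]

/-- The tuple chains supported on tuples contained in a member of `𝒰`. -/
abbrev smallChains (R : Type v) [Ring R] {X : Type u} (𝒰 : Set (Set X)) (n : ℕ) :
    Submodule R (TupleChain R X n) :=
  Finsupp.supported R R {τ | ∃ U ∈ 𝒰, Set.range τ ⊆ U}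

/-- The controlled maps `F` from tuples to `𝒰`-small tuple chains, and chain homotopies `H` from
the identity to `F`, for every open cover `𝒰`. -/
theorem exists_controlled_homotopy (hU : UniformlyAcyclicAtInfinity R X)
    (hL : LocallyAcyclicAtInfinity R X) :
    ∃ b : X, ∀ 𝒰 : Set (Set X), (∀ U ∈ 𝒰, IsOpen U) → (∀ x, ∃ U ∈ 𝒰, x ∈ U) →
      ∃ (F : ∀ n, (Fin (n + 1) → X) → TupleChain R X n)
        (H : ∀ n, TupleChain R X n →ₗ[R] TupleChain R X (n + 1))
        (G : ∀ n, (Fin (n + 1) → X) → Prop),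
        (∀ n σ, G (n + 1) σ → tupleBoundary R X (n + 1) (H (n + 1) (Finsupp.single σ 1)) +
          H n (tupleBoundary R X n (Finsupp.single σ 1)) = Finsupp.single σ 1 - F (n + 1) σ) ∧
        (∀ n σ, F n σ ∈ smallChains R 𝒰 n) ∧
        (∀ n (r : ℝ), 0 ≤ r → ∃ s D : ℝ, 0 ≤ s ∧ ∀ σ : Fin (n + 1) → X,
          (∀ i j, dist (σ i) (σ j) ≤ r) → (∀ i, D ≤ dist (σ i) b) → G n σ ∧
            F n σ ∈ tupleChainsIn R (tupleNhd σ s) n ∧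
            H n (Finsupp.single σ 1) ∈ tupleChainsIn R (tupleNhd σ s) (n + 1)) ∧
        ∃ D : ℝ, ∀ n x, D ≤ dist x b → ∀ ε > 0, ∃ δ > 0, ∀ σ : Fin (n + 1) → X,
          (∀ i, dist (σ i) x < δ) →
            H n (Finsupp.single σ 1) ∈ tupleChainsIn R (Metric.ball x ε) (n + 1) := by
  obtain ⟨b, S, hS0, hfar, D, hnear⟩ := exists_controlled_fillings hU hL
  refine ⟨b, fun 𝒰 ho hc => ?_⟩
  obtain ⟨P, hP0, hP, hPsmall⟩ := exists_smallTuples R ho hc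
  have hPin : ∀ (n : ℕ) {A : Set X} {c : SingularChain R X n}, c ∈ singularChainsIn R A n →
      P n c ∈ tupleChainsIn R A n := fun n A c hc => by
    refine map_mem_of_mem_supported _ _ (fun s hs => ?_) hc
    have hsub : {τ : Fin (n + 1) → X | Set.range τ ⊆ Set.range s ∧ ∃ U ∈ 𝒰, Set.range τ ⊆ U} ⊆
        {τ | Set.range τ ⊆ A} := fun τ hτ => hτ.1.trans hs
    exact Finsupp.supported_mono hsub (hPsmall n s)
  have hF0 : ∀ σ, P 0 (S 0 σ) = Finsupp.single σ 1 := fun σ => by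
    rw [hS0, hP0, eq_const_of_fin_one σ]
    rfl
  refine ⟨fun n σ => P n (S n σ), coneHomotopy fun n σ => P n (S n σ), IsFilled S,
    fun n σ hσ => ?_, fun n σ => ?_, fun n r hr => ?_, D, fun n x hx ε hε => ?_⟩
  · refine tupleBoundary_coneHomotopy (fun _ _ h => h.1) hF0 (fun n σ h => ?_) hσ
    rw [hP, h.2]
    have hcomp : P n ∘ₗ tupleLift (S n) = tupleLift fun σ => P n (S n σ) :=
      linearMap_ext_single fun σ => by
        rw [LinearMap.comp_apply, tupleLift_single, tupleLift_single]
    exact LinearMap.congr_fun hcomp _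
  · refine map_mem_of_mem_supported (s := Set.univ) (P n) _ (fun s _ => ?_) fun _ _ => trivial
    have hsub : {τ : Fin (n + 1) → X | Set.range τ ⊆ Set.range s ∧ ∃ U ∈ 𝒰, Set.range τ ⊆ U} ⊆
        {τ | ∃ U ∈ 𝒰, Set.range τ ⊆ U} := fun τ hτ => hτ.2
    exact Finsupp.supported_mono hsub (hPsmall n s)
  · induction n with
    | zero =>
      obtain ⟨s, D, hs, h⟩ := hfar 0 r hr
      exact ⟨s, D, hs, fun σ hσ hD => ⟨(h σ hσ hD).1, hPin 0 (h σ hσ hD).2, zero_mem _⟩⟩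
    | succ n ih =>
      obtain ⟨s, D, hs, h⟩ := hfar (n + 1) r hr
      obtain ⟨s', D', hs', h'⟩ := ih
      refine ⟨max s s', max D D', hs.trans (le_max_left _ _), fun σ hσ hD => ?_⟩
      obtain ⟨h1, h2⟩ := h σ hσ fun i => (le_max_left _ _).trans (hD i)
      have h3 := tupleChainsIn_mono (tupleNhd_mono σ (le_max_left s s')) _ (hPin _ h2)
      refine ⟨h1, h3, ?_⟩
      rw [coneHomotopy_succ_single]
      have hrange := range_subset_tupleNhd σ (hs.trans (le_max_left s s'))
      -- The apex is a vertex of `σ`, so coning does not leave the neighbourhood.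
      refine cone_mem_tupleChainsIn (hrange ⟨0, rfl⟩) (sub_mem (sub_mem
        (single_one_mem_supported hrange) h3) (map_tupleBoundary_single_mem _ _ _ fun i => ?_))
      exact tupleChainsIn_mono ((tupleNhd_face σ i s').trans (tupleNhd_mono σ (le_max_right s s')))
        _ (h' _ (fun _ _ => hσ _ _) fun _ => (le_max_right _ _).trans (hD _)).2.2
  · induction n with
    | zero => exact ⟨1, one_pos, fun σ _ => zero_mem _⟩
    | succ n ih =>
      obtain ⟨δ, hδ, h⟩ := hnear (n + 1) x hx ε hε
      obtain ⟨δ', hδ', h'⟩ := ih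
      -- The tuple `σ` itself enters the cone, hence the bound by `ε`.
      refine ⟨min (min δ δ') ε, by positivity, fun σ hσ => ?_⟩
      have hrange : Set.range σ ⊆ Metric.ball x ε := by
        rintro _ ⟨i, rfl⟩
        exact (hσ i).trans_le (min_le_right _ _)
      have hσ' : ∀ i, dist (σ i) x < min δ δ' := fun i => (hσ i).trans_le (min_le_left _ _)
      rw [coneHomotopy_succ_single]
      refine cone_mem_tupleChainsIn (hrange ⟨0, rfl⟩) (sub_mem (sub_mem
        (single_one_mem_supported hrange)
        (hPin _ (h σ fun i => (hσ' i).trans_le (min_le_left _ _)).2))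
        (map_tupleBoundary_single_mem _ _ _ fun i => ?_))
      exact h' _ fun _ => (hσ' _).trans_le (min_le_right _ _)

/-! ### Criteria for cochains to be coarse or boundedly supported -/

/-- Distance to the diagonal and the largest distance between entries bound each other up to a
factor of two. For tuples of bounded size it does not matter whether one entry or every entry is
required to be far from `b`, up to a change of the constant. -/
theorem mem_coarseCochains_iff (b : X) {n : ℕ} {φ : Cochain R X n} :
    φ ∈ coarseCochains R X n ↔ ∀ r : ℝ, 0 ≤ r → ∃ D : ℝ, ∀ σ : Fin (n + 1) → X,
      (∀ i j, dist (σ i) (σ j) ≤ r) → (∀ i, D ≤ dist (σ i) b) → φ σ = 0 := by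
  constructor
  · intro h r hr
    obtain ⟨M, hM⟩ := (h (r + 1)).subset_closedBall (diag n b)
    refine ⟨max M 0 + 1, fun σ hσ hD => ?_⟩
    by_contra hne
    have hmem : σ ∈ Metric.thickening (r + 1) (Set.range (diag (X := X) n)) :=
      Metric.mem_thickening_iff.2 ⟨_, ⟨σ 0, rfl⟩, (dist_const_le hσ).trans_lt (by linarith)⟩
    have h1 : dist σ (diag n b) ≤ M := hM ⟨hne, hmem⟩
    have h2 := dist_le_pi_dist σ (diag n b) 0
    linarith [hD 0, le_max_left M 0]
  · intro h r
    rcases le_or_gt r 0 with hr | hr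
    · rw [Metric.thickening_of_nonpos hr, Set.inter_empty]
      exact Bornology.isBounded_empty
    obtain ⟨D, hD⟩ := h (r + r) (by positivity)
    refine (Metric.isBounded_closedBall (x := diag n b) (r := r + r + max D 0)).subset ?_
    rintro σ ⟨hσ, hthick⟩
    obtain ⟨_, ⟨x, rfl⟩, hx⟩ := Metric.mem_thickening_iff.1 hthick
    have hx' : ∀ i, dist (σ i) x < r := (dist_pi_lt_iff hr).1 hx
    have hpair : ∀ i j, dist (σ i) (σ j) ≤ r + r := fun i j => by
      linarith [dist_triangle_right (σ i) (σ j) x, hx' i, hx' j]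
    have hex : ∃ i, dist (σ i) b < D := by
      by_contra! hfar
      exact hσ (hD σ hpair hfar)
    obtain ⟨i, hi⟩ := hex
    refine (dist_pi_le_iff (by positivity)).2 fun j => ?_
    linarith [dist_triangle (σ j) (σ i) b, hpair j i, le_max_left D 0]

theorem notMem_diagSupport_iff {n : ℕ} {φ : Cochain R X n} {x : X} :
    x ∉ diagSupport φ ↔ ∃ ε > 0, ∀ σ : Fin (n + 1) → X, (∀ i, dist (σ i) x < ε) → φ σ = 0 := by
  change ¬ diag n x ∈ closure (Function.support φ) ↔ _
  rw [Metric.mem_closure_iff]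
  push Not
  refine exists_congr fun ε => and_congr_right fun hε => forall_congr' fun σ => ?_
  rw [← not_lt, dist_comm, dist_pi_lt_iff hε, Function.mem_support]
  tauto

theorem mem_boundedCochains_iff (b : X) {n : ℕ} {φ : Cochain R X n} :
    φ ∈ boundedCochains R X n ↔ ∃ D : ℝ, ∀ x, D ≤ dist x b →
      ∃ ε > 0, ∀ σ : Fin (n + 1) → X, (∀ i, dist (σ i) x < ε) → φ σ = 0 := by
  change Bornology.IsBounded (diagSupport φ) ↔ _
  simp only [← notMem_diagSupport_iff]
  constructor
  · intro h
    obtain ⟨M, hM⟩ := h.subset_closedBall b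
    refine ⟨M + 1, fun x hx hmem => ?_⟩
    have := Metric.mem_closedBall.1 (hM hmem)
    linarith
  · rintro ⟨D, hD⟩
    refine (Metric.isBounded_closedBall (x := b) (r := D)).subset fun x hx => ?_
    by_contra hfar
    exact hD x (not_le.1 (fun h => hfar (Metric.mem_closedBall.2 h))).le hx

/-- A `1`-tuple is its own diagonal point, so vanishing near far diagonal points already means
vanishing on all far tuples. -/
theorem mem_coarseCochains_zero {φ : Cochain R X 0} (h : φ ∈ boundedCochains R X 0) (b : X) :
    φ ∈ coarseCochains R X 0 := by
  obtain ⟨D, hD⟩ := (mem_boundedCochains_iff b).1 h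
  refine (mem_coarseCochains_iff b).2 fun r _ => ⟨D, fun σ _ hσ => ?_⟩
  obtain ⟨ε, hε, h⟩ := hD (σ 0) (hσ 0)
  exact h σ fun i => by rwa [Fin.fin_one_eq_zero i, dist_self]

/-- Every boundedly supported cochain `ψ` of positive degree differs from a coarse cochain by the
coboundary of a boundedly supported cochain, provided that `dψ` is coarse. -/
theorem exists_sub_coboundary_mem_coarseCochains (hU : UniformlyAcyclicAtInfinity R X)
    (hL : LocallyAcyclicAtInfinity R X) {n : ℕ} {ψ : Cochain R X (n + 1)}
    (hψ : ψ ∈ boundedCochains R X (n + 1))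
    (hdψ : coboundary R X (n + 1) ψ ∈ coarseCochains R X (n + 2)) :
    ∃ θ ∈ boundedCochains R X n, ψ - coboundary R X n θ ∈ coarseCochains R X (n + 1) := by
  obtain ⟨b, hmain⟩ := exists_controlled_homotopy hU hL
  obtain ⟨M, hM⟩ := (mem_boundedCochains_iff b).1 hψ
  -- The cover consists of open sets on whose tuples `ψ` vanishes and of open subsets of a ball
  -- about `b`, which take care of the points where `ψ` is not controlled. Far tuples cannot lie in
  -- a set of the second kind.
  obtain ⟨F, H, G, hFH, hsmall, hfar, D, hnear⟩ := hmain
    {U | IsOpen U ∧ ((∀ σ : Fin (n + 2) → X, Set.range σ ⊆ U → ψ σ = 0) ∨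
      U ⊆ Metric.ball b (M + 1))} (fun U hU => hU.1) (fun x => by
        by_cases hx : M ≤ dist x b
        · obtain ⟨ε, hε, h⟩ := hM x hx
          exact ⟨Metric.ball x ε, ⟨Metric.isOpen_ball, Or.inl fun σ hσ => h σ fun i => hσ ⟨i, rfl⟩⟩,
            Metric.mem_ball_self hε⟩
        · refine ⟨Metric.ball b (M + 1), ⟨Metric.isOpen_ball, Or.inr subset_rfl⟩, ?_⟩
          rw [Metric.mem_ball]
          linarith)
  refine ⟨fun σ => evalCochain ψ (H n (Finsupp.single σ 1)), ?_, ?_⟩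
  · refine (mem_boundedCochains_iff b).2 ⟨max D M, fun x hx => ?_⟩
    obtain ⟨ε, hε, h⟩ := hM x ((le_max_right _ _).trans hx)
    obtain ⟨δ, hδ, h'⟩ := hnear n x ((le_max_left _ _).trans hx) ε hε
    exact ⟨δ, hδ, fun σ hσ => evalCochain_eq_zero (s := {τ | Set.range τ ⊆ Metric.ball x ε})
      (fun τ hτ => h τ fun i => hτ ⟨i, rfl⟩) (h' σ hσ)⟩
  · have heval : evalCochain (fun σ => evalCochain ψ (H n (Finsupp.single σ 1))) =
        evalCochain ψ ∘ₗ H n := linearMap_ext_single fun σ => by simp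
    -- This is `ψ` evaluated on the homotopy identity: `ψ(∂Hσ)` is `dψ(Hσ)` and `ψ(H∂σ)` is the
    -- coboundary of `ψ ∘ H` at `σ`.
    have hkey : ∀ σ, G (n + 1) σ →
        (ψ - coboundary R X n fun σ => evalCochain ψ (H n (Finsupp.single σ 1))) σ =
          evalCochain ψ (F (n + 1) σ) +
            evalCochain (coboundary R X (n + 1) ψ) (H (n + 1) (Finsupp.single σ 1)) := by
      intro σ hσ
      have h1 := evalCochain_coboundary (fun σ => evalCochain ψ (H n (Finsupp.single σ 1)))
        (Finsupp.single σ (1 : R))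
      rw [evalCochain_single, one_mul, heval, LinearMap.comp_apply] at h1
      have h2 := congrArg (evalCochain ψ) (hFH n σ hσ)
      rw [map_add, map_sub, evalCochain_single, one_mul, ← h1, ← evalCochain_coboundary] at h2
      rw [Pi.sub_apply, sub_eq_iff_eq_add, add_assoc, h2]
      abel
    refine (mem_coarseCochains_iff b).2 fun r hr => ?_
    obtain ⟨s, D₁, hs, h⟩ := hfar (n + 1) r hr
    -- Tuples in the `s`-neighbourhood of `σ` have entries at mutual distance at most `s + r + s`.
    obtain ⟨D₂, hD₂⟩ := (mem_coarseCochains_iff b).1 hdψ (s + r + s) (by positivity)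
    refine ⟨max D₁ (max (M + 1 + s) (D₂ + s)), fun σ hσ hD => ?_⟩
    obtain ⟨hG, hF, hH⟩ := h σ hσ fun i => (le_max_left _ _).trans (hD i)
    have hdist : ∀ y ∈ tupleNhd σ s, M + 1 ≤ dist y b ∧ D₂ ≤ dist y b := by
      rintro y ⟨i, hi⟩
      have h1 := (le_max_right _ _).trans (hD i)
      have h2 := dist_triangle_left (σ i) b y
      exact ⟨by linarith [le_max_left (M + 1 + s) (D₂ + s)],
        by linarith [le_max_right (M + 1 + s) (D₂ + s)]⟩
    rw [hkey σ hG]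
    have hz1 : evalCochain ψ (F (n + 1) σ) = 0 := by
      refine evalCochain_eq_zero (s := {τ | Set.range τ ⊆ tupleNhd σ s ∧
        ∃ U ∈ {U : Set X | IsOpen U ∧ ((∀ σ : Fin (n + 2) → X, Set.range σ ⊆ U → ψ σ = 0) ∨
          U ⊆ Metric.ball b (M + 1))}, Set.range τ ⊆ U}) ?_ fun τ hτ => ⟨hF hτ, hsmall _ _ hτ⟩
      rintro τ ⟨hτ, U, ⟨-, hU | hU⟩, hτU⟩
      · exact hU τ hτU
      · have h1 := Metric.mem_ball.1 (hU (hτU ⟨0, rfl⟩))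
        linarith [(hdist _ (hτ ⟨0, rfl⟩)).1]
    have hz2 : evalCochain (coboundary R X (n + 1) ψ) (H (n + 1) (Finsupp.single σ 1)) = 0 :=
      evalCochain_eq_zero (s := {τ | Set.range τ ⊆ tupleNhd σ s}) (fun τ hτ => hD₂ τ
        (fun i j => dist_le_of_mem_tupleNhd hσ (hτ ⟨i, rfl⟩) (hτ ⟨j, rfl⟩))
        fun i => (hdist _ (hτ ⟨i, rfl⟩)).2) hH
    rw [hz1, hz2, add_zero]

end Metric

/-! ## The comparison in cohomology -/

/-- An elementwise criterion for a chain map to induce an isomorphism in homology. -/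
theorem isIso_homologyMap_of_elements {R : Type u} [Ring R] {ι : Type*} {c : ComplexShape ι}
    {K L : HomologicalComplex (ModuleCat.{v} R) c} (f : K ⟶ L) {i j k : ι} (hi : c.prev j = i)
    (hk : c.next j = k)
    (hinj : ∀ x : K.X j, K.d j k x = 0 → (∃ y, L.d i j y = f.f j x) → ∃ y, K.d i j y = x)
    (hsurj : ∀ x : L.X j, L.d j k x = 0 → ∃ x', K.d j k x' = 0 ∧ ∃ y, L.d i j y = x - f.f j x') :
    IsIso (HomologicalComplex.homologyMap f j) := by
  have hcyc : ∀ (M : HomologicalComplex (ModuleCat.{v} R) c) (z : M.cycles j),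
      M.d j k (M.iCycles j z) = 0 := fun M z => by
    rw [← ConcreteCategory.comp_apply, M.iCycles_d]
    rfl
  rw [ConcreteCategory.isIso_iff_bijective]
  constructor
  · refine (injective_iff_map_eq_zero _).2 fun a ha => ?_
    obtain ⟨z, rfl⟩ := homologyπ_surjective j a
    rw [homologyMap_homologyπ_apply, homologyπ_eq_zero_iff hi, iCycles_cyclesMap_apply] at ha
    exact (homologyπ_eq_zero_iff hi z).2 (hinj _ (hcyc K z) ha)
  · intro a
    obtain ⟨z, rfl⟩ := homologyπ_surjective j a
    obtain ⟨x', hx', hy⟩ := hsurj _ (hcyc L z)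
    obtain ⟨z', rfl⟩ := exists_cycle hk x' hx'
    refine ⟨K.homologyπ j z', ?_⟩
    rw [homologyMap_homologyπ_apply, eq_comm, ← sub_eq_zero, ← map_sub, homologyπ_eq_zero_iff hi,
      map_sub, iCycles_cyclesMap_apply]
    exact hy

section Cohomology

variable (R : Type v) [Ring R] (X : Type u) [MetricSpace X]

theorem coarseComplex_d (n : ℕ) : (coarseComplex R X).d n (n + 1) = ModuleCat.ofHom
    ((coboundary R X n).restrict (coboundary_mem_coarseCochains R X n)) := by
  dsimp only [coarseComplex]
  rw [CochainComplex.of_d]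

theorem boundedComplex_d (n : ℕ) : (boundedComplex R X).d n (n + 1) = ModuleCat.ofHom
    ((coboundary R X n).restrict (coboundary_mem_boundedCochains R X n)) := by
  dsimp only [boundedComplex]
  rw [CochainComplex.of_d]

theorem coarseComplex_d_eq_iff {n : ℕ} (φ : coarseCochains R X n) (θ : coarseCochains R X (n + 1)) :
    (coarseComplex R X).d n (n + 1) φ = θ ↔ coboundary R X n φ.1 = θ.1 := by
  rw [coarseComplex_d]
  exact Subtype.ext_iff

theorem boundedComplex_d_eq_iff {n : ℕ} (φ : boundedCochains R X n)
    (θ : boundedCochains R X (n + 1)) :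
    (boundedComplex R X).d n (n + 1) φ = θ ↔ coboundary R X n φ.1 = θ.1 := by
  rw [boundedComplex_d]
  exact Subtype.ext_iff

variable {R X}

theorem isIso_coarseToBounded_zero {b : X} : IsIso (coarseToBounded R X 0) := by
  refine isIso_homologyMap_of_elements (coarseInclusion R X) (i := 0) (k := 1) (by simp) (by simp)
    (fun x _ hx => ?_) fun x hx => ?_
  · obtain ⟨y, hy⟩ := hx
    -- Since nothing precedes degree zero, `prev 0` is `0` and the incoming differential `d 0 0`
    -- vanishes.
    rw [(boundedComplex R X).shape 0 0 (by simp)] at hy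
    have h0 : x = 0 := Subtype.ext (congrArg Subtype.val hy).symm
    exact ⟨0, by rw [h0, map_zero]⟩
  · let x' : coarseCochains R X 0 := ⟨x.1, mem_coarseCochains_zero x.2 b⟩
    refine ⟨x', (coarseComplex_d_eq_iff R X x' 0).2
      ((boundedComplex_d_eq_iff R X x 0).1 hx), 0, ?_⟩
    rw [map_zero, eq_comm, sub_eq_zero]
    rfl

theorem isIso_coarseToBounded_succ (hU : UniformlyAcyclicAtInfinity R X)
    (hL : LocallyAcyclicAtInfinity R X) (n : ℕ) : IsIso (coarseToBounded R X (n + 1)) := by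
  obtain ⟨-, -, b, -⟩ := id hU
  refine isIso_homologyMap_of_elements (coarseInclusion R X) (i := n) (k := n + 2) (by simp)
    (by simp) (fun x _ hx => ?_) fun x hx => ?_
  · obtain ⟨ψ, hψ⟩ := hx
    have hψ' : coboundary R X n ψ.1 = x.1 := (boundedComplex_d_eq_iff R X ψ _).1 hψ
    cases n with
    | zero =>
      exact ⟨(⟨ψ.1, mem_coarseCochains_zero ψ.2 b⟩ : coarseCochains R X 0),
        (coarseComplex_d_eq_iff R X _ x).2 hψ'⟩
    | succ n =>
      -- Subtracting `dθ` leaves the coboundary of `ψ` unchanged, so the corrected cochain is a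
      -- coarse primitive of `x`.
      obtain ⟨θ, -, hθ⟩ := exists_sub_coboundary_mem_coarseCochains hU hL ψ.2
        (by rw [hψ']; exact x.2)
      refine ⟨(⟨_, hθ⟩ : coarseCochains R X (n + 1)), (coarseComplex_d_eq_iff R X _ x).2 ?_⟩
      rw [map_sub, coboundary_coboundary, sub_zero, hψ']
  · have hx' : coboundary R X (n + 1) x.1 = 0 := (boundedComplex_d_eq_iff R X x 0).1 hx
    obtain ⟨θ, hθ, h⟩ := exists_sub_coboundary_mem_coarseCochains hU hL x.2
      (by rw [hx']; exact zero_mem _)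
    refine ⟨(⟨_, h⟩ : coarseCochains R X (n + 1)), (coarseComplex_d_eq_iff R X _ 0).2 ?_,
      (⟨θ, hθ⟩ : boundedCochains R X n), (boundedComplex_d_eq_iff R X _ _).2 ?_⟩
    · rw [map_sub, coboundary_coboundary, sub_zero, hx']
      rfl
    · exact (sub_sub_cancel _ _).symm

end Cohomology

end CoarseCohomology

theorem mainTheorem2 (R : Type v) [Ring R] (X : Type u) [MetricSpace X]
    (hU : CoarseCohomology.UniformlyAcyclicAtInfinity R X)
    (hL : CoarseCohomology.LocallyAcyclicAtInfinity R X) :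
    ∀ n : ℕ, IsIso (CoarseCohomology.coarseToBounded R X n) := by
  obtain ⟨-, -, b, -⟩ := id hU
  intro n
  cases n with
  | zero => exact CoarseCohomology.isIso_coarseToBounded_zero (b := b)
  | succ n => exact CoarseCohomology.isIso_coarseToBounded_succ hU hL n
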